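/- **Definitions.** Let $\Sigma$ be an ordered alphabet with $\sigma$ characters. For a string $S$ over $\Sigma$, the parent-distance encoding $\mathsf{PD}(S)$ is the sequence of length $|S|$ with $\mathsf{PD}(S)[i] = i - \max\{j < i : S[j] \le S[i]\}$ if such a $j$ exists, and $\mathsf{PD}(S)[i] = 0$ otherwise. Write $S[i..]$ for the suffix of $S$ starting at position $i$. The *sequence hash tree* of a sequence $w_1,\dots,w_k$ is the trie obtained from the one-node trie by inserting, for $j = 1,\dots,k$, the shortest prefix of $w_j$ that is not yet a node (a node is identified with the label sequence of its path from the root). The *Cartesian-tree position heap* $\mathsf{CPH}(S)$ of a string $S$ of length $n$ is the sequence hash tree of $\mathsf{PD}(S[n..]), \mathsf{PD}(S[n-1..]), \dots, \mathsf{PD}(S[1..])$. A *front pointer* of a sequence $u$ is a position $f \ge 2$ with $f - u[f] = 1$; let $\mathcal F_u$ be the set of front pointers. For a non-root node $u$, let $\mathsf{sl}(u)$ be obtained from $u$ by replacing the entries at all front pointers by $0$ and deleting the first entry. The *reversed suffix link* $\mathsf{rsl}(v,a) = u$ is present iff $\mathsf{sl}(u) = v$ and $|\mathcal F_u| = a$.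 **Algorithm 1** processes a non-empty string $S$ of length $n$ from right to left and maintains a trie, a table of reversed suffix links, and the node $u(i)$ created last. * For $i = n$ the trie consists of the root $r$ and its child $u(n)$ with edge label $0$, and $\mathsf{rsl}(r,0) = u(n)$. * For $i = n-1,\dots,1$: let $d \in [1,|u(i+1)|]$ be least such that the $d$-th ancestor $v$ of $u(i+1)$ has a reversed suffix link with label $a$, where $a$ is the number of front pointers of $\mathsf{PD}(S[i..i+|v|])$; this $v$ is found by climbing from $u(i+1)$ towards the root. Let $p = \mathsf{rsl}(v,a)$. Create a child $u(i)$ of $p$ whose edge label is the entry of $\mathsf{PD}(S[i..])$ at position $|p|+1$, and a link $\mathsf{rsl}(\hat v, b) = u(i)$, where $\hat v$ is the $(d-1)$-th ancestor of $u(i+1)$, and $b = a+1$ if position $|p|+1$ is a front pointer of $\mathsf{PD}(S[i..])$, and $b = a$ otherwise. **Theorem 1.** For every non-empty string $S$ of length $n$ and every $i = n,\dots,1$, each iteration of Algorithm 1 finds the required objects. After the iteration for $i$ its trie is $\mathsf{CPH}(S[i..])$, its table consists of exactly the reversed suffix links of $\mathsf{CPH}(S[i..])$, and $u(i)$ is the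 shortest prefix of $\mathsf{PD}(S[i..])$ that is not a node of $\mathsf{CPH}(S[i+1..])$. Moreover, Algorithm 1 can be carried out, with the characters arriving online from right to left and accessible only through comparisons, in a total of $O(n \log \sigma)$ time and $O(n)$ space. That is, there is one word-RAM program, the same for all ordered alphabets and all strings, with the following properties: on every $S$ it goes through the successive states and visited nodes of Algorithm 1, keeping the trie in memory as linked node records together with the reversed suffix links; it uses $O(n)$ memory cells holding numbers of size $O(n)$; and it stops after $O(n(1+\log\sigma))$ steps. The implied constants are absolute. -/

import Mathlib

namespace CartesianHeap

/-! ## Parent-distance encoding, sequence hash trees, position heaps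

Sequences are lists; positions are `0`-based. -/

section Encoding

variable {α : Type*} [LinearOrder α]

/-- The entry of the parent-distance encoding of `S` at position `i`: the distance from `i` to the
nearest `j < i` with `S[j] ≤ S[i]`, and `0` if there is no such `j`. -/
def pdAt (S : List α) (i : Fin S.length) : ℕ :=
  let J : Finset (Fin S.length) := Finset.univ.filter (fun j => j < i ∧ S.get j ≤ S.get i)
  if h : J.Nonempty then (i : ℕ) - (J.max' h : ℕ) else 0

/-- The parent-distance encoding of a string. -/
def pd (S : List α) : List ℕ := List.ofFn (fun i : Fin S.length => pdAt S i)

/-- The parent-distance encodings of the non-empty suffixes of `S`, by increasing length. -/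
def suffixEncodings (S : List α) : List (List ℕ) :=
  (S.tails.filter (fun s => s.length ≠ 0)).reverse.map pd

end Encoding

/-- A trie over `ℕ`. A node is identified with the sequence of edge labels on the path from the
root to it, so that a trie is the finite set of its nodes; the root is `[]`, and there is an edge
labelled `c` from `p` to `u` iff `u = p ++ [c]`. -/
abbrev Trie := Finset (List ℕ)

/-- The shortest prefix of `w` that is not a node of `T`, if there is one. -/
def newNode (T : Trie) (w : List ℕ) : Option (List ℕ) :=
  w.inits.find? (fun q => decide (q ∉ T))

/-- Insert the shortest prefix of `w` that is not yet present. -/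
def shtInsert (T : Trie) (w : List ℕ) : Trie :=
  match newNode T w with
  | some u => insert u T
  | none => T

/-- The sequence hash tree of a sequence of strings. -/
def sht (W : List (List ℕ)) : Trie := W.foldl shtInsert {[]}

/-- The Cartesian-tree position heap of `S`. -/
def cph {α : Type*} [LinearOrder α] (S : List α) : Trie := sht (suffixEncodings S)

/-! ## Front pointers and reversed suffix links -/

/-- The front pointers of `u`: the positions other than the first one whose entry is the distance
to the first position. -/
def frontPointers (u : List ℕ) : Finset ℕ :=
  (Finset.range u.length).filter (fun q => 1 ≤ q ∧ u[q]? = some q)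

/-- The suffix link: replace the front pointers by `0` and remove the first entry. -/
def suffixLink (u : List ℕ) : List ℕ :=
  (u.mapIdx (fun q x => if q ∈ frontPointers u then 0 else x)).tail

/-- In the trie `T`, the reversed suffix link of `v` with label `a` leads to `u`. -/
def IsRsl (T : Trie) (v : List ℕ) (a : ℕ) (u : List ℕ) : Prop :=
  v ∈ T ∧ u ∈ T ∧ u ≠ [] ∧ suffixLink u = v ∧ a = (frontPointers u).card

/-- The `d`-th ancestor of the node `u`, for `d ≤ |u|`. -/
def anc (u : List ℕ) (d : ℕ) : List ℕ := u.take (u.length - d)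

/-! ## The construction algorithm -/

/-- What the algorithm maintains: the tree, the table of reversed suffix links (partial in the
node and the label), and the node created last. -/
structure AlgState where
  nodes : Trie
  rsl : List ℕ → ℕ → Option (List ℕ)
  last : List ℕ

/-- The base case: the root, one child of it with edge label `0`, and the reversed suffix link
with label `0` from the root to this child. -/
def AlgState.base : AlgState where
  nodes := {[], [0]}
  rsl := fun v a => if v = [] ∧ a = 0 then some [0] else none
  last := [0]

section Algorithm

variable {α : Type*} [LinearOrder α]

/-- The number of front pointers of the encoding of the prefix of length `|v| + 1` of `S`. -/
def rslLabel (S : List α) (v : List ℕ) : ℕ :=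
  (frontPointers (pd (S.take (v.length + 1)))).card

/-- Climb from the node created last: the least `d` in `[1, |last|]` such that the `d`-th ancestor
`v` of `last` has a reversed suffix link labelled `rslLabel S v`. -/
def climbDist (A : AlgState) (S : List α) : Option ℕ :=
  (List.range' 1 A.last.length).find?
    (fun d => (A.rsl (anc A.last d) (rslLabel S (anc A.last d))).isSome)

/-- One iteration. `A` is the state for the previous suffix, and `S` is the new suffix, which has
one more character in front. The result is `none` if some object to be followed is missing. -/
def iteration (A : AlgState) (S : List α) : Option AlgState :=
  (climbDist A S).bind fun d =>
    let v := anc A.last d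
    let a := rslLabel S v
    (A.rsl v a).bind fun p =>
      ((pd S)[p.length]?).bind fun c =>
        let u := p ++ [c]
        let b := if p.length ∈ frontPointers (pd S) then a + 1 else a
        let v' := anc A.last (d - 1)
        some
          { nodes := insert u A.nodes
            rsl := fun x y => if x = v' ∧ y = b then some u else A.rsl x y
            last := u }

/-- The state of the algorithm when the string `S` has been processed from right to left. -/
def algorithm : List α → Option AlgState
  | [] => none
  | [_] => some AlgState.base
  | x :: y :: S => (algorithm (y :: S)).bind fun A => iteration A (x :: y :: S)

end Algorithm

/-- What can be observed of the algorithm: its state, the node at which it currently is, and the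
number of characters it has received. -/
structure Snapshot where
  state : AlgState
  current : List ℕ
  received : ℕ

section Snapshots

variable {α : Type*} [LinearOrder α]

/-- The nodes visited one after the other while the algorithm climbs in order to process the
new suffix `S`: the ancestors number `1, …, d` of the node created last. -/
def climbSnapshots (A : AlgState) (S : List α) : List Snapshot :=
  (List.range' 1 ((climbDist A S).getD 0)).map fun e => ⟨A, anc A.last e, S.length⟩

/-- The whole course of the algorithm on `S`, in chronological order. For each new character: the
climb of the iteration (none in the base case), then the completed state, whose current node is
the one just created. -/
def snapshots : List α → List Snapshot
  | [] => []
  | x :: S =>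
    snapshots S ++
      ((algorithm S).elim [] fun A => climbSnapshots A (x :: S)) ++
      ((algorithm (x :: S)).elim [] fun B => [⟨B, B.last, (x :: S).length⟩])

end Snapshots

/-! ## A word RAM with an online input of characters of an ordered alphabet

The machine has `N` memory cells; a cell or a register holds a number `< N`. Every instruction
costs one step. Characters can only be compared, and only after they have been received. The
registers that a program uses are finitely many, as their indices are constants in its text. -/

/-- Instructions; `r`, `s`, `t` are register indices, and `l` is a position in the program. -/
inductive Instr where
  /-- `r := k` -/
  | const (r k : ℕ)
  /-- `r := s` -/
  | move (r s : ℕ)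
  /-- `r := s + t` -/
  | add (r s t : ℕ)
  /-- `r := s - t`, truncated at `0` -/
  | sub (r s t : ℕ)
  /-- `r := s * t` -/
  | mul (r s t : ℕ)
  /-- `r := ⌊s / t⌋` -/
  | div (r s t : ℕ)
  /-- `r := mem[s]` -/
  | load (r s : ℕ)
  /-- `mem[s] := t` -/
  | store (s t : ℕ)
  /-- go to `l` -/
  | jump (l : ℕ)
  /-- go to `l` if `s < t` -/
  | jumpLt (s t l : ℕ)
  /-- go to `l` if `s = t` -/
  | jumpEq (s t l : ℕ)
  /-- receive the next character; go to `l` if there is none -/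
  | receive (l : ℕ)
  /-- go to `l` if the character received as number `s` is at most the one received as number `t`
  (numbers start from `0`) -/
  | jumpCharLe (s t l : ℕ)
  /-- stop -/
  | halt

/-- Configurations of the machine. -/
structure Config where
  pc : ℕ
  reg : ℕ → ℕ
  mem : ℕ → ℕ
  received : ℕ

namespace Config

/-- The initial configuration. -/
def init : Config := ⟨0, fun _ => 0, fun _ => 0, 0⟩

/-- Continue with the next instruction. -/
def next (c : Config) : Config := { c with pc := c.pc + 1 }

/-- Continue at `l`. -/
def goto (c : Config) (l : ℕ) : Config := { c with pc := l }

/-- Write a value to a register; this fails if the value does not fit into a word. -/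
def write (c : Config) (N r v : ℕ) : Option Config :=
  if v < N then some { c.next with reg := Function.update c.reg r v } else none

end Config

section Machine

variable {α : Type*} [LinearOrder α]

/-- One step of the machine with `N` cells running `P`, where `X` is the sequence of characters in
the order in which they arrive. The result is `none` if the machine has stopped, or in case of an
error: a word overflow, an address outside of the memory, a comparison of characters that have not
been received, or a program counter outside of the program. -/
def step (P : List Instr) (N : ℕ) (X : List α) (c : Config) : Option Config :=
  match P[c.pc]? with
  | none => none
  | some (.const r k) => c.write N r k
  | some (.move r s) => c.write N r (c.reg s)
  | some (.add r s t) => c.write N r (c.reg s + c.reg t)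
  | some (.sub r s t) => c.write N r (c.reg s - c.reg t)
  | some (.mul r s t) => c.write N r (c.reg s * c.reg t)
  | some (.div r s t) => c.write N r (c.reg s / c.reg t)
  | some (.load r s) => if c.reg s < N then c.write N r (c.mem (c.reg s)) else none
  | some (.store s t) =>
      if c.reg s < N then
        some { c.next with mem := Function.update c.mem (c.reg s) (c.reg t) }
      else none
  | some (.jump l) => some (c.goto l)
  | some (.jumpLt s t l) => some (if c.reg s < c.reg t then c.goto l else c.next)
  | some (.jumpEq s t l) => some (if c.reg s = c.reg t then c.goto l else c.next)
  | some (.receive l) =>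
      if c.received < X.length then some { c.next with received := c.received + 1 }
      else some (c.goto l)
  | some (.jumpCharLe s t l) =>
      if c.reg s < c.received ∧ c.reg t < c.received then
        match X[c.reg s]?, X[c.reg t]? with
        | some x, some y => some (if x ≤ y then c.goto l else c.next)
        | _, _ => none
      else none
  | some .halt => none

/-- `cs` is the list of all configurations, from the initial one to `final`, of a run of `P` that
stops regularly. The run takes `cs.length` steps if the final `halt` is counted. -/
def IsRun (P : List Instr) (N : ℕ) (X : List α) (cs : List Config) (final : Config) : Prop :=
  cs.head? = some Config.init ∧
  cs.IsChain (fun c c' => step P N X c = some c') ∧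
  cs.getLast? = some final ∧
  P[final.pc]? = some Instr.halt

end Machine

/-! ## How the data of the algorithm lie in the memory -/

/-- `x` is the address of the first record of a linked list of the nodes `vs`, where cell `3` of a
record points to the next record, and `0` is the null pointer. -/
def LinkedList (mem : ℕ → ℕ) (addr : List ℕ → ℕ) : ℕ → List (List ℕ) → Prop
  | x, [] => x = 0
  | x, v :: vs => x = addr v ∧ LinkedList mem addr (mem (addr v + 3)) vs

/-- The configuration `c` of the machine with `N` cells holds the snapshot `s`. Each node `u` has a
record at an address `addr u ≠ 0`. Its cells `0, …, 5` contain: the address of the parent (`0` for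
the root), the label of the edge from the parent (`0` for the root), the address of the first child,
that of the next sibling, and the source and the label of the reversed suffix link that leads
to `u`. Register `0` points to the root, and register `1` to the current node. -/
def Holds (N : ℕ) (c : Config) (s : Snapshot) : Prop :=
  c.received = s.received ∧
  ∃ addr : List ℕ → ℕ,
    Set.InjOn addr (s.state.nodes : Set (List ℕ)) ∧
    s.current ∈ s.state.nodes ∧
    c.reg 0 = addr [] ∧
    c.reg 1 = addr s.current ∧
    ∀ u ∈ s.state.nodes,
      0 < addr u ∧ addr u + 5 < N ∧
      c.mem (addr u) = (if u = [] then 0 else addr u.dropLast) ∧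
      c.mem (addr u + 1) = u.getLastD 0 ∧
      (∃ vs : List (List ℕ), vs.Nodup ∧
        (∀ v, v ∈ vs ↔ v ∈ s.state.nodes ∧ ∃ a, v = u ++ [a]) ∧
        LinkedList c.mem addr (c.mem (addr u + 2)) vs) ∧
      (u ≠ [] → ∀ v ∈ s.state.nodes, ∀ a,
        s.state.rsl v a = some u ↔ (c.mem (addr u + 4) = addr v ∧ c.mem (addr u + 5) = a))

/-- The program `P`, on the string `S` received from right to left, with `N` words of memory, runs
the algorithm on `S` in at most `t` steps: the configurations in which the program counter is `l`
hold, one after the other, the snapshots of the algorithm, and at the end the memory holds the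
final result. -/
def Executes {α : Type*} [LinearOrder α] (P : List Instr) (l N t : ℕ) (S : List α) : Prop :=
  ∃ (cs : List Config) (final : Config),
    IsRun P N S.reverse cs final ∧ cs.length ≤ t ∧
    List.Forall₂ (Holds N) (cs.filter (fun c => decide (c.pc = l))) (snapshots S) ∧
    ∀ A, algorithm S = some A → Holds N final ⟨A, A.last, S.length⟩

end CartesianHeap

/-!
# Online construction of Cartesian-tree position heaps

**Correctness.** Putting a character `x` in front of `s` changes the parent distances only at the
positions without parent whose character is at least `x`; they become the front pointers
(`pd_cons_succ`). Positions without parent carry decreasing characters, so the front pointers are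
an initial segment of them. Hence `pd s` is the suffix link of `pd (x :: s)`, and it determines
`pd (x :: s)` together with the number of front pointers (`suffixLink_pd_cons`,
`pd_cons_eq_of_card`): reversed suffix links are unique, and following one from a prefix of `pd s`
under the right label leads to the prefix of `pd (x :: s)` that is one longer, if this is a node
(`IsCorrect.rsl_take`). In a heap the suffix link of a node is a node of the heap of the next
shorter suffix (`suffixLink_mem_cph_tail`). Therefore the node to be created is at most one level
deeper than the node created last (`IsNewDepth.le_succ`), and its parent is found on the path from
the latter to the root (`IsCorrect.step`).

**Complexity.** The program keeps three things besides the tree. The positions without parent form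
a stack, on which a new character pops exactly the positions that become front pointers; this
maintains all parent distances and yields the label at the node created last
(`Runs.receive_and_pop`). During the climb the label drops by one at each front pointer that is
left. The reversed suffix links with a common source are kept in a digital search tree: its nodes
are the targets of the links, and the binary digits of the labels tell the way. Labels are at most
`σ`, since front pointers carry different characters (`card_frontPointers_pd_le`), so a search takes
`O(1 + log σ)` steps without any rebalancing, and a tree needs no memory besides the records of
the nodes. The last failing search of the climb has found the place at which the new link is to be
inserted, as this link starts at the node before the one where the climb ends (`TreeInv.create`).

The number of elements on the stack and `O(1 + log σ)` times the depth of the node created last form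
a potential, which pays for the pops and for the climbs (`Ready.step`).
-/

namespace CartesianHeap

/-! ### Parent distances and front pointers -/

section Encoding

variable {α : Type*} [LinearOrder α]

/-- `d` is the parent distance of position `i` of `S`, by its defining property. -/
def IsParentDist (S : List α) (i : ℕ) (hi : i < S.length) (d : ℕ) : Prop :=
  (d = 0 ∧ ∀ j (hj : j < i), S[i] < S[j]) ∨
  (0 < d ∧ ∃ hd : d ≤ i, S[i - d] ≤ S[i] ∧ ∀ k (hk : k < i), i - d < k → S[i] < S[k])

theorem IsParentDist.le {S : List α} {i d : ℕ} {hi : i < S.length}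
    (h : IsParentDist S i hi d) : d ≤ i := by
  rcases h with ⟨rfl, _⟩ | ⟨_, hd, _⟩
  · exact Nat.zero_le _
  · exact hd

theorem IsParentDist.unique {S : List α} {i d e : ℕ} {hi : i < S.length}
    (h : IsParentDist S i hi d) (h' : IsParentDist S i hi e) : d = e := by
  rcases h with ⟨rfl, h⟩ | ⟨h0, hd, h1, h2⟩ <;> rcases h' with ⟨rfl, h'⟩ | ⟨h0', hd', h1', h2'⟩
  · rfl
  · exact absurd h1' (not_le.2 (h _ (by omega)))
  · exact absurd h1 (not_le.2 (h' _ (by omega)))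
  · rcases lt_trichotomy d e with h | h | h
    · exact absurd h1 (not_le.2 (h2' _ (by omega) (by omega)))
    · exact h
    · exact absurd h1' (not_le.2 (h2 _ (by omega) (by omega)))

@[simp] theorem length_pd (S : List α) : (pd S).length = S.length := by simp [pd]

@[simp] theorem pd_nil : pd ([] : List α) = [] := rfl

theorem isParentDist_pd (S : List α) (i : ℕ) (hi : i < S.length) :
    IsParentDist S i hi ((pd S)[i]'(by simpa using hi)) := by
  have e : (pd S)[i]'(by simpa using hi) = pdAt S ⟨i, hi⟩ := by simp [pd]
  rw [e]
  unfold pdAt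
  set J : Finset (Fin S.length) :=
    Finset.univ.filter (fun j => j < ⟨i, hi⟩ ∧ S.get j ≤ S.get ⟨i, hi⟩) with hJ
  by_cases h : J.Nonempty
  · simp only [h, dite_true]
    obtain ⟨-, h1, h2⟩ := Finset.mem_filter.1 (J.max'_mem h)
    have h1' : (J.max' h : ℕ) < i := h1
    refine Or.inr ⟨by omega, by omega, ?_, fun k hk hk' => ?_⟩
    · have : i - (i - (J.max' h : ℕ)) = (J.max' h : ℕ) := by omega
      simp only [this]
      exact h2
    · by_contra hc
      have hkJ : (⟨k, by omega⟩ : Fin S.length) ∈ J := by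
        rw [hJ, Finset.mem_filter]
        exact ⟨Finset.mem_univ _, hk, not_lt.1 hc⟩
      have := J.le_max' _ hkJ
      have : k ≤ (J.max' h : ℕ) := this
      omega
  · simp only [h, dite_false]
    refine Or.inl ⟨rfl, fun j hj => ?_⟩
    by_contra hc
    exact h ⟨⟨j, by omega⟩, by
      rw [hJ, Finset.mem_filter]
      exact ⟨Finset.mem_univ _, hj, not_lt.1 hc⟩⟩

theorem pd_getElem_eq {S : List α} {i d : ℕ} (hi : i < S.length) (h : IsParentDist S i hi d) :
    (pd S)[i]'(by simpa using hi) = d :=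
  (isParentDist_pd S i hi).unique h

theorem pd_getElem_le (S : List α) (i : ℕ) (hi : i < (pd S).length) : (pd S)[i] ≤ i :=
  (isParentDist_pd S i (by simpa using hi)).le

/-- The encoding of a prefix is a prefix of the encoding. -/
theorem pd_take (S : List α) (k : ℕ) : pd (S.take k) = (pd S).take k := by
  refine List.ext_getElem (by simp) fun i h1 h2 => ?_
  have hi : i < k ∧ i < S.length := by simpa using h1
  rw [List.getElem_take]
  refine pd_getElem_eq (by simpa using hi) ?_
  have h := isParentDist_pd S i hi.2
  simpa [IsParentDist, List.getElem_take] using h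

theorem pd_cons_zero (x : α) (s : List α) : (pd (x :: s))[0]'(by simp) = 0 :=
  Nat.le_zero.1 (pd_getElem_le _ _ _)

/-- A new first character becomes the parent of the positions without parent whose character is
not smaller; the other parent distances do not change. -/
theorem pd_cons_succ (x : α) (s : List α) (q : ℕ) (hq : q < s.length) :
    (pd (x :: s))[q + 1]'(by simpa using hq) =
      if (pd s)[q]'(by simpa using hq) = 0 ∧ x ≤ s[q] then q + 1
      else (pd s)[q]'(by simpa using hq) := by
  refine pd_getElem_eq (by simpa using hq) ?_
  have h := isParentDist_pd s q hq
  generalize (pd s)[q]'(by simpa using hq) = d at h ⊢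
  rcases h with ⟨rfl, h⟩ | ⟨h0, hd, h1, h2⟩
  · by_cases hx : x ≤ s[q]
    · simp only [hx, and_self, if_true]
      refine Or.inr ⟨by omega, le_rfl, by simpa using hx, fun k hk hk' => ?_⟩
      obtain ⟨k, rfl⟩ : ∃ k', k = k' + 1 := ⟨k - 1, by omega⟩
      simpa using h k (by omega)
    · simp only [hx, and_false, if_false]
      refine Or.inl ⟨rfl, fun k hk => ?_⟩
      rcases k with _ | k
      · simpa using hx
      · simpa using h k (by omega)
  · rw [if_neg (by omega)]
    refine Or.inr ⟨h0, by omega, ?_, fun k hk hk' => ?_⟩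
    · have e : q + 1 - d = (q - d) + 1 := by omega
      simp only [e, List.getElem_cons_succ]
      exact h1
    · obtain ⟨k, rfl⟩ : ∃ k', k = k' + 1 := ⟨k - 1, by omega⟩
      simpa using h2 k (by omega) (by omega)

/-- The positions without parent carry strictly decreasing characters. -/
theorem getElem_lt_of_pd_eq_zero (s : List α) {q q' : ℕ} (hq : q < q') (hq' : q' < s.length)
    (h : (pd s)[q']'(by simpa using hq') = 0) : s[q'] < s[q] := by
  have h' := isParentDist_pd s q' hq'
  rw [h] at h'
  rcases h' with ⟨_, h'⟩ | ⟨h0, _⟩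
  · exact h' q hq
  · exact absurd h0 (lt_irrefl _)

theorem mem_frontPointers {u : List ℕ} {q : ℕ} :
    q ∈ frontPointers u ↔ 1 ≤ q ∧ u[q]? = some q := by
  simp only [frontPointers, Finset.mem_filter, Finset.mem_range]
  refine ⟨fun h => h.2, fun h => ⟨?_, h⟩⟩
  exact (List.getElem?_eq_some_iff.1 h.2).1

theorem succ_mem_frontPointers_pd_cons (x : α) (s : List α) (q : ℕ) :
    q + 1 ∈ frontPointers (pd (x :: s)) ↔
      ∃ hq : q < s.length, (pd s)[q]'(by simpa using hq) = 0 ∧ x ≤ s[q] := by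
  rw [mem_frontPointers]
  constructor
  · rintro ⟨-, h⟩
    obtain ⟨hq, h⟩ := List.getElem?_eq_some_iff.1 h
    have hq : q < s.length := by simpa using hq
    rw [pd_cons_succ x s q hq] at h
    refine ⟨hq, ?_⟩
    by_contra hc
    rw [if_neg hc] at h
    have := pd_getElem_le s q (by simpa using hq)
    omega
  · rintro ⟨hq, h⟩
    refine ⟨by omega, List.getElem?_eq_some_iff.2 ⟨by simpa using hq, ?_⟩⟩
    rw [pd_cons_succ x s q hq, if_pos h]

theorem zero_notMem_frontPointers (u : List ℕ) : 0 ∉ frontPointers u := by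
  simp [mem_frontPointers]

/-- The suffix link of an encoding encodes the string without its first character. -/
theorem suffixLink_pd_cons (x : α) (s : List α) : suffixLink (pd (x :: s)) = pd s := by
  refine List.ext_getElem (by simp [suffixLink]) fun q h1 h2 => ?_
  have hq : q < s.length := by simpa using h2
  simp only [suffixLink, List.getElem_tail, List.getElem_mapIdx]
  split_ifs with h
  · rw [succ_mem_frontPointers_pd_cons] at h
    obtain ⟨_, h, _⟩ := h
    exact h.symm
  · rw [succ_mem_frontPointers_pd_cons] at h
    rw [pd_cons_succ x s q hq, if_neg (fun h' => h ⟨hq, h'⟩)]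

/-- An encoding is determined by its suffix link and its number of front pointers, because the
front pointers are an initial segment of the positions without parent in the suffix link. -/
theorem pd_cons_eq_of_card {x y : α} {s t : List α} (h : pd s = pd t)
    (hc : (frontPointers (pd (x :: s))).card = (frontPointers (pd (y :: t))).card) :
    pd (x :: s) = pd (y :: t) := by
  have hl : s.length = t.length := by simpa using congrArg List.length h
  have down : ∀ (z : α) (w : List α) (q q' : ℕ) (hw : q' + 1 ∈ frontPointers (pd (z :: w)))
      (hqq : q ≤ q') (hq : q < (pd w).length) (_ : (pd w)[q] = 0),
      q + 1 ∈ frontPointers (pd (z :: w)) := by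
    intro z w q q' hw hqq hq h0
    rw [succ_mem_frontPointers_pd_cons] at hw ⊢
    obtain ⟨hq', h0', hz⟩ := hw
    refine ⟨by simpa using hq, h0, ?_⟩
    rcases hqq.eq_or_lt with rfl | hlt
    · exact hz
    · exact hz.trans (getElem_lt_of_pd_eq_zero w hlt hq' h0').le
  have zero : ∀ (z : α) (w : List α) (q : ℕ) (_ : q + 1 ∈ frontPointers (pd (z :: w))),
      ∃ hq : q < (pd w).length, (pd w)[q] = 0 := by
    intro z w q hq
    rw [succ_mem_frontPointers_pd_cons] at hq
    obtain ⟨hq, h0, _⟩ := hq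
    exact ⟨by simpa using hq, h0⟩
  -- of two initial segments of the positions without parent, one contains the other
  have key : frontPointers (pd (x :: s)) = frontPointers (pd (y :: t)) := by
    by_cases hsub : frontPointers (pd (x :: s)) ⊆ frontPointers (pd (y :: t))
    · exact Finset.eq_of_subset_of_card_le hsub hc.ge
    · refine (Finset.eq_of_subset_of_card_le ?_ hc.le).symm
      obtain ⟨q, hq, hq'⟩ := Finset.not_subset.1 hsub
      intro r hr
      obtain ⟨q, rfl⟩ : ∃ k, q = k + 1 := Nat.exists_eq_succ_of_ne_zero
        (fun h0 => zero_notMem_frontPointers _ (h0 ▸ hq))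
      obtain ⟨r, rfl⟩ : ∃ k, r = k + 1 := Nat.exists_eq_succ_of_ne_zero
        (fun h0 => zero_notMem_frontPointers _ (h0 ▸ hr))
      obtain ⟨hqs, hq0⟩ := zero x s q hq
      obtain ⟨hrt, hr0⟩ := zero y t r hr
      rcases le_total q r with hle | hle
      · refine absurd (down y t q r hr hle ?_ ?_) hq'
        · rw [← h]; exact hqs
        · simp only [← h]; exact hq0
      · refine down x s r q hq hle ?_ ?_
        · rw [h]; exact hrt
        · simp only [h]; exact hr0
  refine List.ext_getElem (by simp [hl]) fun q h1 h2 => ?_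
  rcases q with _ | q
  · rw [pd_cons_zero, pd_cons_zero]
  · have hqs : q < s.length := by simpa using h1
    have hqt : q < t.length := by simpa using h2
    have k1 := Finset.ext_iff.1 key (q + 1)
    rw [succ_mem_frontPointers_pd_cons, succ_mem_frontPointers_pd_cons] at k1
    rw [pd_cons_succ x s q hqs, pd_cons_succ y t q hqt]
    have e : (pd s)[q]'(by simpa using hqs) = (pd t)[q]'(by simpa using hqt) := by simp only [h]
    simp only [hqs, hqt, exists_true_left, e] at k1
    simp only [k1, e]

theorem frontPointers_take_succ (w : List ℕ) (k : ℕ) :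
    frontPointers (w.take (k + 1)) =
      if k ∈ frontPointers w then insert k (frontPointers (w.take k))
      else frontPointers (w.take k) := by
  ext q
  split_ifs with h
  · simp only [Finset.mem_insert, mem_frontPointers, List.getElem?_take] at h ⊢
    rcases lt_trichotomy q k with hq | rfl | hq
    · simp [hq, hq.ne, Nat.lt_succ_of_lt hq]
    · simp [h.1, h.2]
    · simp [hq.ne', not_lt.2 hq.le, show ¬ q < k + 1 by omega]
  · simp only [mem_frontPointers, List.getElem?_take] at h ⊢
    rcases lt_trichotomy q k with hq | rfl | hq
    · simp [hq, Nat.lt_succ_of_lt hq]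
    · simpa using h
    · simp [not_lt.2 hq.le, show ¬ q < k + 1 by omega]

theorem card_frontPointers_take_succ (w : List ℕ) (k : ℕ) :
    (frontPointers (w.take (k + 1))).card =
      (frontPointers (w.take k)).card + if k ∈ frontPointers w then 1 else 0 := by
  rw [frontPointers_take_succ]
  split_ifs with h
  · rw [Finset.card_insert_of_notMem]
    simp [mem_frontPointers]
  · rfl

/-- Front pointers carry different characters. -/
theorem card_frontPointers_pd_le [Fintype α] (S : List α) :
    (frontPointers (pd S)).card ≤ Fintype.card α := by
  rcases S with _ | ⟨x, s⟩
  · simp [frontPointers]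
  refine Finset.card_le_card_of_injOn (t := Finset.univ)
    (fun q => s.getD (q - 1) x) (fun _ _ => Finset.mem_univ _) ?_
  have key : ∀ q r, q + 1 ∈ frontPointers (pd (x :: s)) → r + 1 ∈ frontPointers (pd (x :: s)) →
      q < r → s.getD q x ≠ s.getD r x := by
    intro q r hq hr hlt
    rw [succ_mem_frontPointers_pd_cons] at hq hr
    obtain ⟨hq, -, -⟩ := hq
    obtain ⟨hr, hr0, -⟩ := hr
    rw [List.getD_eq_getElem _ _ hq, List.getD_eq_getElem _ _ hr]
    exact (getElem_lt_of_pd_eq_zero s hlt hr hr0).ne'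
  intro q hq r hr hqr
  obtain ⟨q, rfl⟩ : ∃ k, q = k + 1 := Nat.exists_eq_succ_of_ne_zero
    (fun h0 => zero_notMem_frontPointers _ (h0 ▸ hq))
  obtain ⟨r, rfl⟩ : ∃ k, r = k + 1 := Nat.exists_eq_succ_of_ne_zero
    (fun h0 => zero_notMem_frontPointers _ (h0 ▸ hr))
  simp only [Nat.add_sub_cancel] at hqr
  rcases lt_trichotomy q r with h | h | h
  · exact absurd hqr (key q r hq hr h)
  · rw [h]
  · exact absurd hqr.symm (key r q hr hq h)

end Encoding

/-! ### Position heaps -/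

section Heap

variable {α : Type*} [LinearOrder α]

theorem newNode_eq_some {T : Trie} {w u : List ℕ} :
    newNode T w = some u ↔
      ∃ k ≤ w.length, u = w.take k ∧ w.take k ∉ T ∧ ∀ j < k, w.take j ∈ T := by
  rw [newNode, List.find?_eq_some_iff_getElem]
  constructor
  · rintro ⟨h, k, hk, rfl, h'⟩
    rw [List.length_inits] at hk
    refine ⟨k, by omega, by simp, by simpa using h, fun j hj => ?_⟩
    simpa using h' j hj
  · rintro ⟨k, hk, rfl, h, h'⟩
    refine ⟨by simpa using h, k, by rw [List.length_inits]; omega, by simp, fun j hj => ?_⟩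
    simpa using h' j hj

theorem suffixEncodings_cons (x : α) (s : List α) :
    suffixEncodings (x :: s) = suffixEncodings s ++ [pd (x :: s)] := by
  simp [suffixEncodings]

theorem cph_nil : cph ([] : List α) = {[]} := by simp [cph, suffixEncodings, sht]

theorem cph_cons (x : α) (s : List α) : cph (x :: s) = shtInsert (cph s) (pd (x :: s)) := by
  simp [cph, sht, suffixEncodings_cons]

theorem subset_cph_cons (x : α) (s : List α) : cph s ⊆ cph (x :: s) := by
  rw [cph_cons, shtInsert]
  split
  · exact Finset.subset_insert _ _
  · exact Finset.Subset.refl _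

/-- `k` is the depth of the node that the heap of `S` has in addition to the heap of the suffix
`S.tail`. -/
structure IsNewDepth (S : List α) (k : ℕ) : Prop where
  pos : 1 ≤ k
  le_length : k ≤ S.length
  notMem : (pd S).take k ∉ cph S.tail
  mem_of_lt : ∀ j < k, (pd S).take j ∈ cph S.tail
  eq_insert : cph S = insert ((pd S).take k) (cph S.tail)

theorem nil_mem_cph (s : List α) : [] ∈ cph s := by
  induction s with
  | nil => simp [cph_nil]
  | cons x s ih => exact subset_cph_cons x s ih

theorem cph_cons_cases {x : α} {s : List α} {u : List ℕ} (h : u ∈ cph (x :: s)) :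
    u ∈ cph s ∨ newNode (cph s) (pd (x :: s)) = some u := by
  rw [cph_cons, shtInsert] at h
  split at h
  · rename_i v hv
    rcases Finset.mem_insert.1 h with rfl | h
    · exact Or.inr hv
    · exact Or.inl h
  · exact Or.inl h

/-- The nodes of a heap are encodings of short strings. -/
theorem exists_pd_of_mem_cph {s : List α} {u : List ℕ} (h : u ∈ cph s) :
    ∃ t : List α, u = pd t ∧ t.length ≤ s.length := by
  induction s with
  | nil => exact ⟨[], by simpa [cph_nil] using h, le_rfl⟩
  | cons x s ih =>
    rcases cph_cons_cases h with h | h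
    · obtain ⟨t, rfl, ht⟩ := ih h
      exact ⟨t, rfl, ht.trans (by simp)⟩
    · obtain ⟨k, hk, rfl, -, -⟩ := newNode_eq_some.1 h
      exact ⟨(x :: s).take k, by rw [pd_take], by simp⟩

theorem length_le_of_mem_cph {s : List α} {u : List ℕ} (h : u ∈ cph s) :
    u.length ≤ s.length := by
  obtain ⟨t, rfl, ht⟩ := exists_pd_of_mem_cph h
  simpa using ht

theorem take_mem_cph {s : List α} {u : List ℕ} (h : u ∈ cph s) (j : ℕ) : u.take j ∈ cph s := by
  induction s with
  | nil =>
    rw [cph_nil, Finset.mem_singleton] at h ⊢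
    simp [h]
  | cons x s ih =>
    rcases cph_cons_cases h with h' | h'
    · exact subset_cph_cons x s (ih h')
    · obtain ⟨k, hk, rfl, -, h2⟩ := newNode_eq_some.1 h'
      rcases le_or_gt k j with hj | hj
      · rwa [List.take_of_length_le (by simp [hj])]
      · rw [List.take_take, min_eq_left hj.le]
        exact subset_cph_cons x s (h2 j hj)

/-- A heap has depth at most the length of its string, so the next encoding is never exhausted. -/
theorem exists_isNewDepth (x : α) (s : List α) : ∃ k, IsNewDepth (x :: s) k := by
  have hex : ∃ k, (pd (x :: s)).take k ∉ cph s := by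
    refine ⟨s.length + 1, fun h => ?_⟩
    have := length_le_of_mem_cph h
    simp at this
  have hk := Nat.find_spec hex
  have hlt := fun j => Nat.find_min (m := j) hex
  set k := Nat.find hex
  have hle : k ≤ s.length + 1 := Nat.find_le (by
    intro h
    have := length_le_of_mem_cph h
    simp at this)
  refine ⟨k, ?_, by simpa using hle, hk, fun j hj => not_not.1 (hlt j hj), ?_⟩
  · rcases Nat.eq_zero_or_pos k with h | h
    · rw [h] at hk
      exact absurd (nil_mem_cph s) (by simpa using hk)
    · exact h
  · have : newNode (cph s) (pd (x :: s)) = some ((pd (x :: s)).take k) :=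
      newNode_eq_some.2 ⟨k, by simpa using hle, rfl, hk, fun j hj => not_not.1 (hlt j hj)⟩
    rw [cph_cons, shtInsert, this, List.tail_cons]

theorem IsNewDepth.newNode {x : α} {s : List α} {k : ℕ} (h : IsNewDepth (x :: s) k) :
    CartesianHeap.newNode (cph s) (pd (x :: s)) = some ((pd (x :: s)).take k) :=
  newNode_eq_some.2 ⟨k, by simpa using h.le_length, rfl, h.notMem, h.mem_of_lt⟩

theorem IsNewDepth.take_mem {S : List α} {k : ℕ} (h : IsNewDepth S k) {j : ℕ} (hj : j ≤ k) :
    (pd S).take j ∈ cph S := by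
  rw [h.eq_insert, Finset.mem_insert]
  rcases hj.eq_or_lt with rfl | hj
  · exact Or.inl rfl
  · exact Or.inr (h.mem_of_lt j hj)

theorem cph_tail_subset (s : List α) : cph s.tail ⊆ cph s := by
  rcases s with _ | ⟨x, s⟩
  · exact Finset.Subset.refl _
  · exact subset_cph_cons x s

theorem suffixLink_take (x : α) (s : List α) (k : ℕ) :
    suffixLink ((pd (x :: s)).take (k + 1)) = (pd s).take k := by
  rw [← pd_take, List.take_succ_cons, suffixLink_pd_cons, pd_take]

theorem depth_le_of_suffixLink_mem {s : List α}
    (hs : ∀ v ∈ cph s, v ≠ [] → suffixLink v ∈ cph s.tail) {x : α} {k l : ℕ}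
    (hk : IsNewDepth (x :: s) k) (hl : IsNewDepth s l) : k ≤ l + 1 := by
  by_contra hlt
  obtain ⟨j, rfl⟩ : ∃ j, k = j + 2 := ⟨k - 2, by omega⟩
  -- the suffix link of the parent would extend the node created before
  have h1 := hk.mem_of_lt (j + 1) (by omega)
  have hlen := hk.le_length
  simp only [List.length_cons] at hlen
  have h2 := hs _ h1 (by
    intro h0
    have := congrArg List.length h0
    simp at this)
  rw [suffixLink_take] at h2
  have h3 := take_mem_cph h2 l
  rw [List.take_take, min_eq_left (by omega)] at h3
  exact hl.notMem h3

/-- Suffix links lead to the heap of the shorter suffix. -/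
theorem suffixLink_mem_cph_tail (s : List α) :
    ∀ v ∈ cph s, v ≠ [] → suffixLink v ∈ cph s.tail := by
  induction s with
  | nil =>
    intro v hv hv'
    rw [cph_nil, Finset.mem_singleton] at hv
    exact absurd hv hv'
  | cons x s ih =>
    intro v hv hv'
    rcases cph_cons_cases hv with h | h
    · exact cph_tail_subset s (ih v h hv')
    · obtain ⟨k, hk⟩ := exists_isNewDepth x s
      rw [hk.newNode, Option.some_inj] at h
      subst h
      obtain ⟨j, rfl⟩ : ∃ j, k = j + 1 := ⟨k - 1, by have := hk.pos; omega⟩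
      rw [suffixLink_take, List.tail_cons]
      rcases s with _ | ⟨y, s⟩
      · simpa using nil_mem_cph _
      · obtain ⟨l, hl⟩ := exists_isNewDepth y s
        have := depth_le_of_suffixLink_mem ih hk hl
        exact hl.take_mem (by omega)

/-- The depth of the created node grows by at most one. -/
theorem IsNewDepth.le_succ {x : α} {s : List α} {k l : ℕ}
    (hk : IsNewDepth (x :: s) k) (hl : IsNewDepth s l) : k ≤ l + 1 :=
  depth_le_of_suffixLink_mem (suffixLink_mem_cph_tail s) hk hl

end Heap

/-! ### Correctness of the algorithm -/

section Algorithm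

variable {α : Type*} [LinearOrder α]

/-- `A` is the correct state of the algorithm for the string `s`, and `k` is the depth of the node
created last. -/
structure IsCorrect (s : List α) (A : AlgState) (k : ℕ) : Prop where
  nodes : A.nodes = cph s
  rsl : ∀ v a u, A.rsl v a = some u ↔ IsRsl A.nodes v a u
  depth : IsNewDepth s k
  last : A.last = (pd s).take k

theorem IsCorrect.length_last {s : List α} {A : AlgState} {k : ℕ} (h : IsCorrect s A k) :
    A.last.length = k := by
  have := h.depth.le_length
  rw [h.last]
  simpa using this

theorem IsCorrect.anc_last {s : List α} {A : AlgState} {k : ℕ} (h : IsCorrect s A k) (d : ℕ) :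
    anc A.last d = (pd s).take (k - d) := by
  rw [anc, h.length_last, h.last, List.take_take, min_eq_left (by omega)]

theorem rslLabel_take (x : α) (s : List α) {j : ℕ} (hj : j ≤ s.length) :
    rslLabel (x :: s) ((pd s).take j) = (frontPointers ((pd (x :: s)).take (j + 1))).card := by
  rw [rslLabel, ← pd_take]
  simp [hj, ← pd_take]

/-- The reversed suffix link that belongs to the prefix of length `j + 1` of the new encoding is
present iff that prefix is a node. -/
theorem IsCorrect.rsl_take {s : List α} {A : AlgState} {k : ℕ} (h : IsCorrect s A k) (x : α)
    {j : ℕ} (hj : j ≤ k) (p : List ℕ) :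
    A.rsl ((pd s).take j) (rslLabel (x :: s) ((pd s).take j)) = some p ↔
      p = (pd (x :: s)).take (j + 1) ∧ p ∈ cph s := by
  have hjs : j ≤ s.length := hj.trans h.depth.le_length
  rw [h.rsl, rslLabel_take x s hjs, IsRsl, h.nodes]
  constructor
  · rintro ⟨-, hu, hne, hsl, hc⟩
    refine ⟨?_, hu⟩
    obtain ⟨t, rfl, -⟩ := exists_pd_of_mem_cph hu
    rcases t with _ | ⟨y, t⟩
    · exact absurd rfl hne
    rw [suffixLink_pd_cons, ← pd_take] at hsl
    rw [← pd_take, List.take_succ_cons] at hc ⊢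
    exact pd_cons_eq_of_card hsl hc.symm
  · rintro ⟨rfl, hp⟩
    refine ⟨h.depth.take_mem hj, hp, ?_, suffixLink_take x s j, rfl⟩
    intro h0
    have := congrArg List.length h0
    simp at this

theorem pd_singleton (x : α) : pd [x] = [0] :=
  List.ext_getElem (by simp) fun i h1 _ => by
    obtain rfl : i = 0 := by simpa using h1
    simpa using pd_cons_zero x []

theorem isCorrect_base (x : α) : IsCorrect [x] AlgState.base 1 := by
  obtain ⟨k, hk⟩ := exists_isNewDepth x ([] : List α)
  obtain rfl : k = 1 := le_antisymm (by simpa using hk.le_length) hk.pos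
  have hT : cph [x] = {[], [0]} := by
    rw [hk.eq_insert, List.tail_cons, cph_nil, pd_singleton]
    exact Finset.pair_comm _ _
  refine ⟨hT.symm, fun v a u => ?_, hk, by rw [pd_singleton]; rfl⟩
  have h0 : suffixLink [0] = [] := rfl
  have h1 : (frontPointers [0]).card = 0 := rfl
  simp only [AlgState.base, IsRsl, Finset.mem_insert, Finset.mem_singleton]
  constructor
  · intro h
    split_ifs at h with hva
    obtain rfl := Option.some_inj.1 h
    simp [hva.1, hva.2, h0, h1]
  · rintro ⟨-, rfl | rfl, hne, hsl, hc⟩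
    · exact absurd rfl hne
    · rw [if_pos ⟨hsl.symm.trans h0, hc.trans h1⟩]

/-- One iteration on a correct state: the climb fails up to the distance `d - 1`, it succeeds at
`d`, and it leads to a correct state. -/
theorem IsCorrect.step {s : List α} {A : AlgState} {k : ℕ} (h : IsCorrect s A k) (x : α) :
    ∃ d, 1 ≤ d ∧ d ≤ k ∧ climbDist A (x :: s) = some d ∧
      (∀ e < d, A.rsl (anc A.last e) (rslLabel (x :: s) (anc A.last e)) = none) ∧
      A.rsl (anc A.last d) (rslLabel (x :: s) (anc A.last d)) =
        some ((pd (x :: s)).take (k - d + 1)) ∧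
      ∃ B, iteration A (x :: s) = some B ∧
        B.nodes = insert B.last A.nodes ∧ IsCorrect (x :: s) B (k - d + 2) := by
  -- `l` is the depth of the new node, so that the prefixes of the new encoding that are nodes are
  -- those of length less than `l`
  obtain ⟨l, hl⟩ := exists_isNewDepth x s
  have hlk := hl.le_succ h.depth
  have hlen := h.depth.le_length
  have hl2 : 2 ≤ l := by
    by_contra hlt
    have hl1 : l = 1 := by have := hl.pos; omega
    have e1 : (pd (x :: s)).take 1 = [0] := by
      rw [← pd_take]
      exact pd_singleton x
    have hs : s ≠ [] := by
      rintro rfl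
      have := h.depth.pos
      simp at hlen
      omega
    obtain ⟨y, s, rfl⟩ := List.exists_cons_of_ne_nil hs
    have h1 : (pd (y :: s)).take 1 = [0] := by
      rw [← pd_take]
      exact pd_singleton y
    have := h.depth.take_mem (j := 1) h.depth.pos
    rw [h1, ← e1, ← hl1] at this
    exact hl.notMem this
  have hrsl : ∀ e ≤ k, A.rsl (anc A.last e) (rslLabel (x :: s) (anc A.last e)) =
      if k - e + 1 < l then some ((pd (x :: s)).take (k - e + 1)) else none := by
    intro e he
    rw [h.anc_last]
    split_ifs with hlt
    · rw [h.rsl_take x (by omega)]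
      exact ⟨rfl, hl.mem_of_lt _ hlt⟩
    · rw [Option.eq_none_iff_forall_ne_some]
      intro p hp
      obtain ⟨rfl, hp⟩ := (h.rsl_take x (by omega) p).1 hp
      refine hl.notMem ?_
      have := take_mem_cph hp l
      rwa [List.take_take, min_eq_left (by omega)] at this
  have hcd : climbDist A (x :: s) = some (k + 2 - l) := by
    rw [climbDist, List.find?_eq_some_iff_getElem, h.length_last]
    refine ⟨?_, k + 1 - l, by rw [List.length_range']; omega,
      by rw [List.getElem_range']; omega, ?_⟩
    · rw [hrsl _ (by omega), if_pos (by omega)]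
      rfl
    · intro j hj
      rw [List.getElem_range', hrsl _ (by omega), if_neg (by omega)]
      rfl
  refine ⟨k + 2 - l, by omega, by omega, hcd, ?_, ?_, ?_⟩
  · intro e he
    rw [hrsl e (by omega), if_neg (by omega)]
  · rw [hrsl _ (by omega), if_pos (by omega)]
  · obtain ⟨l, rfl⟩ : ∃ l', l = l' + 2 := ⟨l - 2, by omega⟩
    have hll : l + 2 ≤ s.length + 1 := by simpa using hl.le_length
    have hkd : k - (k + 2 - (l + 2)) = l := by omega
    set S := x :: s with hS
    have hp : ((pd S).take (l + 1)).length = l + 1 := by simp [hS]; omega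
    have hc : (pd S)[l + 1]? = some ((pd S)[l + 1]'(by simp [hS]; omega)) :=
      List.getElem?_eq_getElem _
    have hu : (pd S).take (l + 1) ++ [(pd S)[l + 1]'(by simp [hS]; omega)] = (pd S).take (l + 2) :=
      (List.take_succ_eq_append_getElem _).symm
    have hv' : anc A.last (k + 2 - (l + 2) - 1) = (pd s).take (l + 1) := by
      rw [h.anc_last]
      congr 1
      omega
    have hb : (if l + 1 ∈ frontPointers (pd S) then rslLabel S ((pd s).take l) + 1
        else rslLabel S ((pd s).take l)) = rslLabel S ((pd s).take (l + 1)) := by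
      rw [rslLabel_take x s (by omega), rslLabel_take x s (by omega),
        card_frontPointers_take_succ _ (l + 1)]
      split_ifs <;> rfl
    rw [hkd]
    refine ⟨⟨insert ((pd S).take (l + 2)) A.nodes,
      fun v a => if v = (pd s).take (l + 1) ∧ a = rslLabel S ((pd s).take (l + 1)) then
        some ((pd S).take (l + 2)) else A.rsl v a, (pd S).take (l + 2)⟩, ?_, ?_⟩
    · rw [iteration, hcd, Option.bind_some]
      simp only [hrsl (k + 2 - (l + 2)) (by omega)]
      rw [if_pos (by omega), hkd, Option.bind_some, hp, hc, Option.bind_some, hv', h.anc_last, hkd,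
        hu, hb]
    refine ⟨rfl, ?_, ?_, hl, rfl⟩
    · simp only [h.nodes]
      exact hl.eq_insert.symm
    · intro v a u
      have hsl : suffixLink ((pd S).take (l + 2)) = (pd s).take (l + 1) := suffixLink_take x s _
      have hcard := rslLabel_take x s (j := l + 1) (by omega)
      simp only
      constructor
      · intro hv
        split_ifs at hv with hva
        · obtain rfl := Option.some_inj.1 hv
          refine ⟨?_, Finset.mem_insert_self _ _, ?_, ?_, ?_⟩
          · rw [hva.1, h.nodes]
            exact Finset.mem_insert_of_mem (h.depth.take_mem (by omega))
          · intro h0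
            have := congrArg List.length h0
            simp [hS] at this
          · rw [hsl, hva.1]
          · rw [hva.2, hcard]
        · obtain ⟨h1, h2, h3⟩ := (h.rsl v a u).1 hv
          exact ⟨Finset.mem_insert_of_mem h1, Finset.mem_insert_of_mem h2, h3⟩
      · rintro ⟨-, h2, h3, h4, h5⟩
        rcases Finset.mem_insert.1 h2 with rfl | h2
        · rw [if_pos ⟨h4.symm.trans hsl, h5.trans hcard.symm⟩]
        · have hr : A.rsl v a = some u := by
            refine (h.rsl v a u).2 ⟨?_, h2, h3, h4, h5⟩
            rw [h.nodes] at h2 ⊢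
            exact h4 ▸ cph_tail_subset s (suffixLink_mem_cph_tail s u h2 h3)
          rw [if_neg, hr]
          rintro ⟨rfl, rfl⟩
          obtain ⟨rfl, hmem⟩ := (h.rsl_take x (by omega) u).1 hr
          exact hl.notMem hmem

end Algorithm

/-! ### Counted runs with a trace -/

/-- A run of `n` steps from one configuration to another, with the list of the configurations, the
last one excluded, whose program counter is `l`. -/
inductive Steps {α : Type*} [LinearOrder α] (P : List Instr) (l N : ℕ) (X : List α) :
    ℕ → List Config → Config → Config → Prop
  | refl (c : Config) : Steps P l N X 0 [] c c
  | silent {n : ℕ} {tr : List Config} {c c' c'' : Config} (hp : c.pc ≠ l)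
      (hs : step P N X c = some c') (h : Steps P l N X n tr c' c'') :
      Steps P l N X (n + 1) tr c c''
  | visible {n : ℕ} {tr : List Config} {c c' c'' : Config} (hp : c.pc = l)
      (hs : step P N X c = some c') (h : Steps P l N X n tr c' c'') :
      Steps P l N X (n + 1) (c :: tr) c c''

section Steps

variable {α : Type*} [LinearOrder α] {P : List Instr} {l N : ℕ} {X : List α}

theorem Steps.append {n m : ℕ} {tr tr' : List Config} {c c' c'' : Config}
    (h : Steps P l N X n tr c c') (h' : Steps P l N X m tr' c' c'') :
    Steps P l N X (n + m) (tr ++ tr') c c'' := by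
  induction h with
  | refl c => simpa using h'
  | silent hp hs _ ih =>
    rw [Nat.add_right_comm]
    exact .silent hp hs (ih h')
  | visible hp hs _ ih =>
    rw [Nat.add_right_comm]
    exact .visible hp hs (ih h')

/-- A silent run followed by another run. -/
theorem Steps.trans {n m : ℕ} {tr : List Config} {c c' c'' : Config}
    (h : Steps P l N X n [] c c') (h' : Steps P l N X m tr c' c'') :
    Steps P l N X (n + m) tr c c'' := by
  simpa using h.append h'

theorem Steps.cast {n m : ℕ} {tr : List Config} {c c' d' : Config}
    (h : Steps P l N X n tr c c') (hn : n = m) (hc : c' = d') : Steps P l N X m tr c d' :=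
  hn ▸ hc ▸ h

/-- The list of all configurations of a run that does not end at the traced program counter. -/
theorem Steps.exists_isChain {n : ℕ} {tr : List Config} {c c' : Config}
    (h : Steps P l N X n tr c c') (hl : c'.pc ≠ l) :
    ∃ cs : List Config, cs.head? = some c ∧
      cs.IsChain (fun c c' => step P N X c = some c') ∧ cs.getLast? = some c' ∧
      cs.length = n + 1 ∧ cs.filter (fun c => decide (c.pc = l)) = tr := by
  induction h with
  | refl c => exact ⟨[c], by simp, by simp, by simp, by simp, by simp [hl]⟩
  | silent hp hs _ ih =>
    obtain ⟨cs, h1, h2, h3, h4, h5⟩ := ih hl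
    rcases cs with _ | ⟨d, cs⟩
    · simp at h4
    · simp only [List.head?_cons, Option.some_inj] at h1
      subst h1
      exact ⟨_ :: d :: cs, rfl, List.isChain_cons_cons.2 ⟨hs, h2⟩,
        by simpa [List.getLast?_cons] using h3, by simpa using h4,
        by rw [List.filter_cons_of_neg (by simpa using hp), h5]⟩
  | visible hp hs _ ih =>
    obtain ⟨cs, h1, h2, h3, h4, h5⟩ := ih hl
    rcases cs with _ | ⟨d, cs⟩
    · simp at h4
    · simp only [List.head?_cons, Option.some_inj] at h1
      subst h1
      exact ⟨_ :: d :: cs, rfl, List.isChain_cons_cons.2 ⟨hs, h2⟩,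
        by simpa [List.getLast?_cons] using h3, by simpa using h4,
        by rw [List.filter_cons_of_pos (by simpa using hp), h5]⟩

end Steps

/-! ### The program -/

/-- The program. Memory is divided into blocks of `16` cells; the root has block `1`, and the node
created for the character received as number `j` has block `j + 2`. Besides the record of the node,
this block contains: in cells `6`, `7` the two children in the digital search tree of the reversed
suffix links from the same source, in cell `8` the root of the digital search tree of the reversed
suffix links from this node, in cell `9` the successor of the character `j` on the stack of the
positions without parent, and in cell `10` the parent distance of the character `j`.

Registers: `0` root, `1` current node, `2` mode (`1` during a climb), `3` number of characters
processed, `4` depth of the current node, `5` label, `6` to `10` temporary, `11`, `12`, `13` place,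
source and label of the last missing link, `14` to `17` the constants `0`, `1`, `2`, `16`. -/
def program : List Instr := [
  .const 15 1, .const 16 2, .const 17 16, .const 0 16, .const 1 32, .const 3 1, .const 4 1,
  .receive 99, .const 7 18, .store 7 1, .const 7 24, .store 7 1, .const 7 36, .store 7 0,
  .store 1 0,
  -- 15: dispatch
  .jumpEq 2 14 73,
  -- 16: search
  .const 7 8, .add 9 1 7, .move 10 5,
  -- 19: search loop
  .load 6 9, .jumpEq 6 14 33, .const 7 5, .add 7 6 7, .load 7 7, .jumpEq 7 5 47, .div 7 10 16,
  .add 8 7 7, .sub 8 10 8, .move 10 7, .const 7 6, .add 9 6 7, .add 9 9 8, .jump 19,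
  -- 33: missing link
  .move 11 9, .move 12 1, .move 13 5, .sub 7 3 4, .add 7 7 16, .mul 7 7 17, .const 8 10,
  .add 7 7 8, .load 7 7, .jumpLt 7 4 44, .sub 5 5 15,
  -- 44: climb
  .load 1 1, .sub 4 4 15, .jump 15,
  -- 47: create
  .add 7 3 16, .mul 1 7 17, .store 1 6, .sub 7 3 4, .add 7 7 15, .mul 7 7 17, .const 8 10,
  .add 7 7 8, .load 7 7, .add 8 1 15, .store 8 7, .add 8 6 16, .load 10 8, .store 8 1,
  .add 8 1 16, .add 8 8 15, .store 8 10, .add 8 8 15, .store 8 12, .add 8 8 15, .store 8 13,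
  .store 11 1, .add 4 4 16, .add 3 3 15, .const 2 0, .jump 15,
  -- 73: next character
  .receive 99, .const 5 0, .const 2 1, .move 6 3,
  -- 77: pop loop
  .jumpEq 6 14 93, .sub 7 6 15, .jumpCharLe 3 7 81, .jump 93,
  -- 81: pop
  .sub 8 3 7, .add 7 6 15, .mul 7 7 17, .const 10 10, .add 10 7 10, .store 10 8, .jumpLt 4 8 89,
  .add 5 5 15,
  -- 89: pop end
  .const 10 9, .add 10 7 10, .load 6 10, .jump 77,
  -- 93: push
  .add 7 3 16, .mul 7 7 17, .const 8 9, .add 7 7 8, .store 7 6, .jump 16,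
  -- 99: halt
  .halt]

/-- The program counter at which the state of the algorithm is observed. -/
abbrev observed : ℕ := 15

/-- The registers with given values; the other registers are `0`. -/
def regs (R : List ℕ) : ℕ → ℕ := fun r => R.getD r 0

/-- The memory whose block `b` contains the number `M f b` in cell `f`. -/
def blocks (M : ℕ → ℕ → ℕ) : ℕ → ℕ := fun y => M (y % 16) (y / 16)

/-- Write `v` to cell `f` of block `b`. -/
def put (M : ℕ → ℕ → ℕ) (f b v : ℕ) : ℕ → ℕ → ℕ :=
  fun g y => if g = f ∧ y = b then v else M g y

theorem blocks_add (M : ℕ → ℕ → ℕ) {f : ℕ} (b : ℕ) (hf : f < 16) :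
    blocks M (16 * b + f) = M f b := by
  unfold blocks
  congr 1 <;> omega

theorem update_blocks (M : ℕ → ℕ → ℕ) {f : ℕ} (b v : ℕ) (hf : f < 16) :
    Function.update (blocks M) (16 * b + f) v = blocks (put M f b v) := by
  funext y
  simp only [Function.update_apply, blocks, put]
  by_cases h : y = 16 * b + f
  · rw [if_pos h, if_pos (by omega)]
  · rw [if_neg h, if_neg (by omega)]

theorem update_regs (R : List ℕ) (r v : ℕ) (hr : r < R.length) :
    Function.update (regs R) r v = regs (R.set r v) := by
  funext x
  simp only [regs, Function.update_apply, List.getD_eq_getElem?_getD, List.getElem?_set]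
  by_cases h : x = r
  · subst h
    simp [hr]
  · simp [h, Ne.symm h]

theorem write_regs {N r v pc rc : ℕ} {R : List ℕ} {mem : ℕ → ℕ}
    (hr : Nat.blt r R.length = true) (hv : v < N) :
    Config.write ⟨pc, regs R, mem, rc⟩ N r v = some ⟨pc + 1, regs (R.set r v), mem, rc⟩ := by
  simp only [Config.write, hv, Config.next, if_true]
  rw [update_regs _ _ _ (by simpa [Nat.blt_eq] using hr)]

section Rules

/-! ### One rule for each instruction -/

variable {α : Type*} [LinearOrder α] {N : ℕ} {X : List α} {pc rc n : ℕ} {R : List ℕ}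
  {M : ℕ → ℕ → ℕ} {tr : List Config} {c' : Config}

/-- A run of `program`, traced at the program counter `observed`. -/
abbrev Runs {α : Type*} [LinearOrder α] (N : ℕ) (X : List α) :
    ℕ → List Config → Config → Config → Prop :=
  Steps program observed N X

theorem Runs.const {r k : ℕ} (hi : program[pc]? = some (.const r k))
    (hp : Nat.beq pc observed = false) (hr : Nat.blt r R.length = true) (hv : k < N)
    (h : Runs N X n tr ⟨pc + 1, regs (R.set r k), blocks M, rc⟩ c') :
    Runs N X (n + 1) tr ⟨pc, regs R, blocks M, rc⟩ c' := by
  refine .silent (Nat.ne_of_beq_eq_false hp) ?_ h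
  simp only [step, hi]
  exact write_regs hr hv

theorem Runs.move {r s v : ℕ} (hi : program[pc]? = some (.move r s))
    (hp : Nat.beq pc observed = false) (hr : Nat.blt r R.length = true)
    (hv : R.getD s 0 = v) (hN : v < N)
    (h : Runs N X n tr ⟨pc + 1, regs (R.set r v), blocks M, rc⟩ c') :
    Runs N X (n + 1) tr ⟨pc, regs R, blocks M, rc⟩ c' := by
  subst hv
  refine .silent (Nat.ne_of_beq_eq_false hp) ?_ h
  simp only [step, hi]
  exact write_regs hr hN

theorem Runs.add {r s t v : ℕ} (hi : program[pc]? = some (.add r s t))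
    (hp : Nat.beq pc observed = false) (hr : Nat.blt r R.length = true)
    (hv : R.getD s 0 + R.getD t 0 = v) (hN : v < N)
    (h : Runs N X n tr ⟨pc + 1, regs (R.set r v), blocks M, rc⟩ c') :
    Runs N X (n + 1) tr ⟨pc, regs R, blocks M, rc⟩ c' := by
  subst hv
  refine .silent (Nat.ne_of_beq_eq_false hp) ?_ h
  simp only [step, hi]
  exact write_regs hr hN

theorem Runs.sub {r s t v : ℕ} (hi : program[pc]? = some (.sub r s t))
    (hp : Nat.beq pc observed = false) (hr : Nat.blt r R.length = true)
    (hv : R.getD s 0 - R.getD t 0 = v) (hN : v < N)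
    (h : Runs N X n tr ⟨pc + 1, regs (R.set r v), blocks M, rc⟩ c') :
    Runs N X (n + 1) tr ⟨pc, regs R, blocks M, rc⟩ c' := by
  subst hv
  refine .silent (Nat.ne_of_beq_eq_false hp) ?_ h
  simp only [step, hi]
  exact write_regs hr hN

theorem Runs.mul {r s t v : ℕ} (hi : program[pc]? = some (.mul r s t))
    (hp : Nat.beq pc observed = false) (hr : Nat.blt r R.length = true)
    (hv : R.getD s 0 * R.getD t 0 = v) (hN : v < N)
    (h : Runs N X n tr ⟨pc + 1, regs (R.set r v), blocks M, rc⟩ c') :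
    Runs N X (n + 1) tr ⟨pc, regs R, blocks M, rc⟩ c' := by
  subst hv
  refine .silent (Nat.ne_of_beq_eq_false hp) ?_ h
  simp only [step, hi]
  exact write_regs hr hN

theorem Runs.div {r s t v : ℕ} (hi : program[pc]? = some (.div r s t))
    (hp : Nat.beq pc observed = false) (hr : Nat.blt r R.length = true)
    (hv : R.getD s 0 / R.getD t 0 = v) (hN : v < N)
    (h : Runs N X n tr ⟨pc + 1, regs (R.set r v), blocks M, rc⟩ c') :
    Runs N X (n + 1) tr ⟨pc, regs R, blocks M, rc⟩ c' := by
  subst hv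
  refine .silent (Nat.ne_of_beq_eq_false hp) ?_ h
  simp only [step, hi]
  exact write_regs hr hN

theorem Runs.load {r s v f b : ℕ} (hi : program[pc]? = some (.load r s))
    (hp : Nat.beq pc observed = false) (hr : Nat.blt r R.length = true)
    (ha : R.getD s 0 = 16 * b + f) (hf : f < 16) (hb : 16 * b + f < N) (hv : M f b = v)
    (hN : v < N) (h : Runs N X n tr ⟨pc + 1, regs (R.set r v), blocks M, rc⟩ c') :
    Runs N X (n + 1) tr ⟨pc, regs R, blocks M, rc⟩ c' := by
  subst hv
  refine .silent (Nat.ne_of_beq_eq_false hp) ?_ h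
  simp only [step, hi]
  have e : regs R s = 16 * b + f := ha
  rw [e, if_pos hb, blocks_add M b hf]
  exact write_regs hr hN

theorem Runs.store {s t v f b : ℕ} (hi : program[pc]? = some (.store s t))
    (hp : Nat.beq pc observed = false) (ha : R.getD s 0 = 16 * b + f) (hf : f < 16)
    (hb : 16 * b + f < N) (hv : R.getD t 0 = v)
    (h : Runs N X n tr ⟨pc + 1, regs R, blocks (put M f b v), rc⟩ c') :
    Runs N X (n + 1) tr ⟨pc, regs R, blocks M, rc⟩ c' := by
  subst hv
  refine .silent (Nat.ne_of_beq_eq_false hp) ?_ h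
  simp only [step, hi]
  have e : regs R s = 16 * b + f := ha
  rw [e, if_pos hb, update_blocks M b _ hf]
  rfl

theorem Runs.jump {q : ℕ} (hi : program[pc]? = some (.jump q))
    (hp : Nat.beq pc observed = false)
    (h : Runs N X n tr ⟨q, regs R, blocks M, rc⟩ c') :
    Runs N X (n + 1) tr ⟨pc, regs R, blocks M, rc⟩ c' := by
  refine .silent (Nat.ne_of_beq_eq_false hp) ?_ h
  simp only [step, hi]
  rfl

theorem Runs.jumpEq_pos {s t q : ℕ} (hi : program[pc]? = some (.jumpEq s t q))
    (hp : Nat.beq pc observed = false) (hst : R.getD s 0 = R.getD t 0)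
    (h : Runs N X n tr ⟨q, regs R, blocks M, rc⟩ c') :
    Runs N X (n + 1) tr ⟨pc, regs R, blocks M, rc⟩ c' := by
  refine .silent (Nat.ne_of_beq_eq_false hp) ?_ h
  simp only [step, hi, regs, hst]
  rfl

theorem Runs.jumpEq_neg {s t q : ℕ} (hi : program[pc]? = some (.jumpEq s t q))
    (hp : Nat.beq pc observed = false) (hst : ¬ R.getD s 0 = R.getD t 0)
    (h : Runs N X n tr ⟨pc + 1, regs R, blocks M, rc⟩ c') :
    Runs N X (n + 1) tr ⟨pc, regs R, blocks M, rc⟩ c' := by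
  refine .silent (Nat.ne_of_beq_eq_false hp) ?_ h
  simp only [step, hi, regs, hst]
  rfl

theorem Runs.jumpLt_pos {s t q : ℕ} (hi : program[pc]? = some (.jumpLt s t q))
    (hp : Nat.beq pc observed = false) (hst : R.getD s 0 < R.getD t 0)
    (h : Runs N X n tr ⟨q, regs R, blocks M, rc⟩ c') :
    Runs N X (n + 1) tr ⟨pc, regs R, blocks M, rc⟩ c' := by
  refine .silent (Nat.ne_of_beq_eq_false hp) ?_ h
  simp only [step, hi, regs, hst]
  rfl

theorem Runs.jumpLt_neg {s t q : ℕ} (hi : program[pc]? = some (.jumpLt s t q))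
    (hp : Nat.beq pc observed = false) (hst : ¬ R.getD s 0 < R.getD t 0)
    (h : Runs N X n tr ⟨pc + 1, regs R, blocks M, rc⟩ c') :
    Runs N X (n + 1) tr ⟨pc, regs R, blocks M, rc⟩ c' := by
  refine .silent (Nat.ne_of_beq_eq_false hp) ?_ h
  simp only [step, hi, regs, hst]
  rfl

theorem Runs.receive_some {q : ℕ} (hi : program[pc]? = some (.receive q))
    (hp : Nat.beq pc observed = false) (hX : rc < X.length)
    (h : Runs N X n tr ⟨pc + 1, regs R, blocks M, rc + 1⟩ c') :
    Runs N X (n + 1) tr ⟨pc, regs R, blocks M, rc⟩ c' := by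
  refine .silent (Nat.ne_of_beq_eq_false hp) ?_ h
  simp only [step, hi, hX]
  rfl

theorem Runs.receive_none {q : ℕ} (hi : program[pc]? = some (.receive q))
    (hp : Nat.beq pc observed = false) (hX : ¬ rc < X.length)
    (h : Runs N X n tr ⟨q, regs R, blocks M, rc⟩ c') :
    Runs N X (n + 1) tr ⟨pc, regs R, blocks M, rc⟩ c' := by
  refine .silent (Nat.ne_of_beq_eq_false hp) ?_ h
  simp only [step, hi, hX]
  rfl

theorem Runs.jumpCharLe {s t q : ℕ} {x y : α} (hi : program[pc]? = some (.jumpCharLe s t q))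
    (hp : Nat.beq pc observed = false) (hs : R.getD s 0 < rc) (ht : R.getD t 0 < rc)
    (hx : X[R.getD s 0]? = some x) (hy : X[R.getD t 0]? = some y)
    (h : Runs N X n tr ⟨if x ≤ y then q else pc + 1, regs R, blocks M, rc⟩ c') :
    Runs N X (n + 1) tr ⟨pc, regs R, blocks M, rc⟩ c' := by
  refine .silent (Nat.ne_of_beq_eq_false hp) ?_ h
  have hs' : regs R s = R.getD s 0 := rfl
  have ht' : regs R t = R.getD t 0 := rfl
  simp only [step, hi, hs', ht', hs, ht, hx, hy, and_self, if_true]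
  split_ifs <;> rfl

theorem Runs.observe_pos (hst : R.getD 2 0 = R.getD 14 0)
    (h : Runs N X n tr ⟨73, regs R, blocks M, rc⟩ c') :
    Runs N X (n + 1) (⟨15, regs R, blocks M, rc⟩ :: tr) ⟨15, regs R, blocks M, rc⟩ c' := by
  refine .visible rfl ?_ h
  simp only [step, show program[15]? = some (.jumpEq 2 14 73) from rfl, regs, hst]
  rfl

theorem Runs.observe_neg (hst : ¬ R.getD 2 0 = R.getD 14 0)
    (h : Runs N X n tr ⟨16, regs R, blocks M, rc⟩ c') :
    Runs N X (n + 1) (⟨15, regs R, blocks M, rc⟩ :: tr) ⟨15, regs R, blocks M, rc⟩ c' := by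
  refine .visible rfl ?_ h
  simp only [step, show program[15]? = some (.jumpEq 2 14 73) from rfl, regs, hst]
  rfl

end Rules

/-! ### Runs of the pieces of straight-line code -/

/-- The contents of the registers between the pieces of the program, for given contents of the
registers `1` to `13`. -/
abbrev file (cur mode m dep a r6 r7 r8 r9 r10 r11 r12 r13 : ℕ) : List ℕ :=
  [16, cur, mode, m, dep, a, r6, r7, r8, r9, r10, r11, r12, r13, 0, 1, 2, 16]

section Pieces

variable {α : Type*} [LinearOrder α] {N : ℕ} {X : List α} {M : ℕ → ℕ → ℕ}
  {cur mode m dep a r6 r7 r8 r9 r10 r11 r12 r13 rc : ℕ}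

/-- The memory after the first character. -/
def initialBlocks : ℕ → ℕ → ℕ :=
  put (put (put (put (fun _ _ => 0) 2 1 32) 8 1 32) 4 2 16) 0 2 16

theorem Runs.first_char (hX : X ≠ []) (hN : 47 < N) :
    Runs N X 15 [] Config.init
      ⟨15, regs (file 32 0 1 1 0 0 36 0 0 0 0 0 0), blocks initialBlocks, 1⟩ := by
  have h0 : Config.init = ⟨0, regs (List.replicate 18 0), blocks (fun _ _ => 0), 0⟩ := by
    simp only [Config.init, Config.mk.injEq, true_and, and_true]
    refine ⟨?_, rfl⟩
    funext r
    rw [regs, List.getD_eq_getElem?_getD, List.getElem?_replicate]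
    split_ifs <;> rfl
  rw [h0]
  refine .const rfl rfl rfl (by omega) ?_
  refine .const rfl rfl rfl (by omega) ?_
  refine .const rfl rfl rfl (by omega) ?_
  refine .const rfl rfl rfl (by omega) ?_
  refine .const rfl rfl rfl (by omega) ?_
  refine .const rfl rfl rfl (by omega) ?_
  refine .const rfl rfl rfl (by omega) ?_
  refine .receive_some rfl rfl (List.length_pos_iff.2 hX) ?_
  refine .const rfl rfl rfl (by omega) ?_
  refine .store (b := 1) (f := 2) (v := 32) rfl rfl rfl (by omega) (by omega) rfl ?_
  refine .const rfl rfl rfl (by omega) ?_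
  refine .store (b := 1) (f := 8) (v := 32) rfl rfl rfl (by omega) (by omega) rfl ?_
  refine .const rfl rfl rfl (by omega) ?_
  refine .store (b := 2) (f := 4) (v := 16) rfl rfl rfl (by omega) (by omega) rfl ?_
  refine .store (b := 2) (f := 0) (v := 16) rfl rfl rfl (by omega) (by omega) rfl ?_
  exact .refl _

theorem Runs.search_start {v : ℕ} (hv : 16 * v + 8 < N) (ha : a < N) :
    Runs N X 3 []
      ⟨16, regs (file (16 * v) mode m dep a r6 r7 r8 r9 r10 r11 r12 r13), blocks M, rc⟩
      ⟨19, regs (file (16 * v) mode m dep a r6 8 r8 (16 * v + 8) a r11 r12 r13),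
        blocks M, rc⟩ := by
  refine .const rfl rfl rfl (by omega) ?_
  refine .add (v := 16 * v + 8) rfl rfl rfl rfl (by omega) ?_
  refine .move (v := a) rfl rfl rfl rfl (by omega) ?_
  exact .refl _

theorem Runs.search_empty {f b : ℕ} (hf : f < 16) (hb : 16 * b + f < N) (h0 : M f b = 0) :
    Runs N X 2 []
      ⟨19, regs (file cur mode m dep a r6 r7 r8 (16 * b + f) r10 r11 r12 r13), blocks M, rc⟩
      ⟨33, regs (file cur mode m dep a 0 r7 r8 (16 * b + f) r10 r11 r12 r13),
        blocks M, rc⟩ := by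
  refine .load (f := f) (b := b) (v := 0) rfl rfl rfl rfl hf hb h0 (by omega) ?_
  refine .jumpEq_pos rfl rfl rfl ?_
  exact .refl _

theorem Runs.search_found {f b w : ℕ} (hf : f < 16) (hb : 16 * b + f < N) (hw : M f b = 16 * w)
    (hw0 : w ≠ 0) (hwN : 16 * w + 15 < N) (hkey : M 5 w = a) (ha : a < N) :
    Runs N X 6 []
      ⟨19, regs (file cur mode m dep a r6 r7 r8 (16 * b + f) r10 r11 r12 r13), blocks M, rc⟩
      ⟨47, regs (file cur mode m dep a (16 * w) a r8 (16 * b + f) r10 r11 r12 r13),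
        blocks M, rc⟩ := by
  refine .load (f := f) (b := b) (v := 16 * w) rfl rfl rfl rfl hf hb hw (by omega) ?_
  refine .jumpEq_neg rfl rfl (show ¬ 16 * w = 0 by omega) ?_
  refine .const rfl rfl rfl (by omega) ?_
  refine .add (v := 16 * w + 5) rfl rfl rfl rfl (by omega) ?_
  refine .load (f := 5) (b := w) (v := a) rfl rfl rfl rfl (by omega) (by omega) hkey ha ?_
  refine .jumpEq_pos rfl rfl rfl ?_
  exact .refl _

theorem Runs.search_next {f b w k : ℕ} (hf : f < 16) (hb : 16 * b + f < N)
    (hw : M f b = 16 * w) (hw0 : w ≠ 0) (hwN : 16 * w + 15 < N) (hkey : M 5 w ≠ a)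
    (hkN : M 5 w < N) (hk : k < N) :
    Runs N X 14 []
      ⟨19, regs (file cur mode m dep a r6 r7 r8 (16 * b + f) k r11 r12 r13), blocks M, rc⟩
      ⟨19, regs (file cur mode m dep a (16 * w) 6 (k % 2) (16 * w + (6 + k % 2)) (k / 2)
        r11 r12 r13), blocks M, rc⟩ := by
  refine .load (f := f) (b := b) (v := 16 * w) rfl rfl rfl rfl hf hb hw (by omega) ?_
  refine .jumpEq_neg rfl rfl (show ¬ 16 * w = 0 by omega) ?_
  refine .const rfl rfl rfl (by omega) ?_
  refine .add (v := 16 * w + 5) rfl rfl rfl rfl (by omega) ?_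
  refine .load (f := 5) (b := w) (v := M 5 w) rfl rfl rfl rfl (by omega) (by omega) rfl hkN ?_
  refine .jumpEq_neg rfl rfl hkey ?_
  refine .div (v := k / 2) rfl rfl rfl rfl (by omega) ?_
  refine .add (v := k / 2 + k / 2) rfl rfl rfl rfl (by omega) ?_
  refine .sub (v := k % 2) rfl rfl rfl (show k - (k / 2 + k / 2) = k % 2 by omega) (by omega) ?_
  refine .move (v := k / 2) rfl rfl rfl rfl (by omega) ?_
  refine .const rfl rfl rfl (by omega) ?_
  refine .add (v := 16 * w + 6) rfl rfl rfl rfl (by omega) ?_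
  refine .add (v := 16 * w + (6 + k % 2)) rfl rfl rfl
    (show 16 * w + 6 + k % 2 = 16 * w + (6 + k % 2) by omega) (by omega) ?_
  refine .jump rfl rfl ?_
  exact .refl _

/-- After a failing search: remember where the link is missing, adapt the label, and climb. -/
theorem Runs.climb {v q p par : ℕ} (hv : 16 * v < N) (ha : a < N) (h9 : r9 < N)
    (hm : 16 * (m + 2) + 15 < N) (hpd : M 10 (m - dep + 2) = q) (hq : q ≤ dep) (hdm : dep ≤ m)
    (hpar : M 0 v = par) (hparN : par < N) (hp : p = if q = dep then 1 else 0) :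
    ∃ n r8', n ≤ 14 ∧ Runs N X n []
      ⟨33, regs (file (16 * v) mode m dep a r6 r7 r8 r9 r10 r11 r12 r13), blocks M, rc⟩
      ⟨15, regs (file par mode m (dep - 1) (a - p) r6 q r8' r9 r10 r9 (16 * v) a),
        blocks M, rc⟩ := by
  have key : ∀ n tr c', Runs N X n tr
      ⟨42, regs (file (16 * v) mode m dep a r6 q 10 r9 r10 r9 (16 * v) a), blocks M, rc⟩ c' →
      Runs N X (n + 9) tr
      ⟨33, regs (file (16 * v) mode m dep a r6 r7 r8 r9 r10 r11 r12 r13), blocks M, rc⟩ c' := by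
    intro n tr c' h
    refine .move (v := r9) rfl rfl rfl rfl (by omega) ?_
    refine .move (v := 16 * v) rfl rfl rfl rfl (by omega) ?_
    refine .move (v := a) rfl rfl rfl rfl (by omega) ?_
    refine .sub (v := m - dep) rfl rfl rfl rfl (by omega) ?_
    refine .add (v := m - dep + 2) rfl rfl rfl rfl (by omega) ?_
    refine .mul (v := 16 * (m - dep + 2)) rfl rfl rfl (Nat.mul_comm _ _) (by omega) ?_
    refine .const rfl rfl rfl (by omega) ?_
    refine .add (v := 16 * (m - dep + 2) + 10) rfl rfl rfl rfl (by omega) ?_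
    refine .load (f := 10) (b := m - dep + 2) (v := q) rfl rfl rfl rfl (by omega) (by omega) hpd
      (by omega) ?_
    exact h
  have last : Runs N X 3 []
      ⟨44, regs (file (16 * v) mode m dep (a - p) r6 q 10 r9 r10 r9 (16 * v) a), blocks M, rc⟩
      ⟨15, regs (file par mode m (dep - 1) (a - p) r6 q 10 r9 r10 r9 (16 * v) a),
        blocks M, rc⟩ := by
    refine .load (f := 0) (b := v) (v := par) rfl rfl rfl rfl (by omega) (by omega) hpar hparN ?_
    refine .sub (v := dep - 1) rfl rfl rfl rfl (by omega) ?_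
    refine .jump rfl rfl ?_
    exact .refl _
  by_cases hqd : q = dep
  · rw [if_pos hqd] at hp
    subst hp
    refine ⟨_, 10, le_rfl, key 5 [] _ ?_⟩
    refine .jumpLt_neg rfl rfl (show ¬ q < dep by omega) ?_
    refine .sub (v := a - 1) rfl rfl rfl rfl (by omega) ?_
    exact last
  · rw [if_neg hqd] at hp
    subst hp
    refine ⟨_, 10, Nat.le_succ _, key 4 [] _ ?_⟩
    refine .jumpLt_pos rfl rfl (show q < dep by omega) ?_
    exact last

/-- The memory after the creation of a node in block `m + 2`, as a new first child of the node in
block `w`: `label` is the label of the edge, `pv` and `pa` are the source and the label of the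
reversed suffix link to the new node, and cell `f` of block `b` belongs to the search tree that
receives this link. -/
def createBlocks (M : ℕ → ℕ → ℕ) (m w label pv pa f b : ℕ) : ℕ → ℕ → ℕ :=
  put (put (put (put (put (put (put M 0 (m + 2) (16 * w)) 1 (m + 2) label) 2 w (16 * (m + 2)))
    3 (m + 2) (M 2 w)) 4 (m + 2) pv) 5 (m + 2) pa) f b (16 * (m + 2))

/-- Creation of a node. Registers `11`, `12`, `13` hold the place in the search tree, the source and
the label of the new reversed suffix link; `dep` is the depth of the node at which the climb has
ended, so that the new node has depth `dep + 2`. -/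
theorem Runs.create {w f b : ℕ} (hm : 16 * (m + 2) + 15 < N) (hdm : dep + 1 ≤ m)
    (hw : 16 * w + 15 < N) (hf : f < 16) (hb : 16 * b + f < N) (h10 : M 10 (m - dep + 1) < N)
    (h2 : M 2 w < N) :
    ∃ r7' r8' r10', Runs N X 26 []
      ⟨47, regs (file cur mode m dep a (16 * w) r7 r8 r9 r10 (16 * b + f) r12 r13),
        blocks M, rc⟩
      ⟨15, regs (file (16 * (m + 2)) 0 (m + 1) (dep + 2) a (16 * w) r7' r8' r9 r10' (16 * b + f)
        r12 r13), blocks (createBlocks M m w (M 10 (m - dep + 1)) r12 r13 f b), rc⟩ := by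
  refine ⟨M 10 (m - dep + 1), 16 * (m + 2) + 5, M 2 w, ?_⟩
  refine .add (v := m + 2) rfl rfl rfl rfl (by omega) ?_
  refine .mul (v := 16 * (m + 2)) rfl rfl rfl (Nat.mul_comm _ _) (by omega) ?_
  refine .store (f := 0) (b := m + 2) (v := 16 * w) rfl rfl rfl (by omega) (by omega) rfl ?_
  refine .sub (v := m - dep) rfl rfl rfl rfl (by omega) ?_
  refine .add (v := m - dep + 1) rfl rfl rfl rfl (by omega) ?_
  refine .mul (v := 16 * (m - dep + 1)) rfl rfl rfl (Nat.mul_comm _ _) (by omega) ?_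
  refine .const rfl rfl rfl (by omega) ?_
  refine .add (v := 16 * (m - dep + 1) + 10) rfl rfl rfl rfl (by omega) ?_
  refine .load (f := 10) (b := m - dep + 1) (v := M 10 (m - dep + 1)) rfl rfl rfl rfl (by omega)
    (by omega) (by simp [put]) h10 ?_
  change Runs N X 17 [] ⟨56, regs (file (16 * (m + 2)) mode m dep a (16 * w) (M 10 (m - dep + 1))
    10 r9 r10 (16 * b + f) r12 r13), _, _⟩ _
  refine .add (v := 16 * (m + 2) + 1) rfl rfl rfl rfl (by omega) ?_
  refine .store (f := 1) (b := m + 2) (v := M 10 (m - dep + 1)) rfl rfl rfl (by omega) (by omega)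
    rfl ?_
  refine .add (v := 16 * w + 2) rfl rfl rfl rfl (by omega) ?_
  refine .load (f := 2) (b := w) (v := M 2 w) rfl rfl rfl rfl (by omega) (by omega)
    (by simp [put]) h2 ?_
  refine .store (f := 2) (b := w) (v := 16 * (m + 2)) rfl rfl rfl (by omega) (by omega) rfl ?_
  change Runs N X 12 [] ⟨61, regs (file (16 * (m + 2)) mode m dep a (16 * w) (M 10 (m - dep + 1))
    (16 * w + 2) r9 (M 2 w) (16 * b + f) r12 r13), _, _⟩ _
  refine .add (v := 16 * (m + 2) + 2) rfl rfl rfl rfl (by omega) ?_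
  refine .add (v := 16 * (m + 2) + 3) rfl rfl rfl rfl (by omega) ?_
  refine .store (f := 3) (b := m + 2) (v := M 2 w) rfl rfl rfl (by omega) (by omega) rfl ?_
  refine .add (v := 16 * (m + 2) + 4) rfl rfl rfl rfl (by omega) ?_
  refine .store (f := 4) (b := m + 2) (v := r12) rfl rfl rfl (by omega) (by omega) rfl ?_
  refine .add (v := 16 * (m + 2) + 5) rfl rfl rfl rfl (by omega) ?_
  refine .store (f := 5) (b := m + 2) (v := r13) rfl rfl rfl (by omega) (by omega) rfl ?_
  change Runs N X 5 [] ⟨68, regs (file (16 * (m + 2)) mode m dep a (16 * w) (M 10 (m - dep + 1))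
    (16 * (m + 2) + 5) r9 (M 2 w) (16 * b + f) r12 r13), _, _⟩ _
  refine .store (f := f) (b := b) (v := 16 * (m + 2)) rfl rfl rfl hf (by omega) rfl ?_
  refine .add (v := dep + 2) rfl rfl rfl rfl (by omega) ?_
  refine .add (v := m + 1) rfl rfl rfl rfl (by omega) ?_
  refine .const rfl rfl rfl (by omega) ?_
  refine .jump rfl rfl ?_
  exact .refl _

theorem Runs.next_char (hX : rc < X.length) (hm : 16 * (m + 2) + 15 < N) :
    Runs N X 4 []
      ⟨73, regs (file cur mode m dep a r6 r7 r8 r9 r10 r11 r12 r13), blocks M, rc⟩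
      ⟨77, regs (file cur 1 m dep 0 m r7 r8 r9 r10 r11 r12 r13), blocks M, rc + 1⟩ := by
  refine .receive_some rfl rfl hX ?_
  refine .const rfl rfl rfl (by omega) ?_
  refine .const rfl rfl rfl (by omega) ?_
  refine .move (v := m) rfl rfl rfl rfl (by omega) ?_
  exact .refl _

theorem Runs.no_char (hX : ¬ rc < X.length) :
    Runs N X 1 []
      ⟨73, regs (file cur mode m dep a r6 r7 r8 r9 r10 r11 r12 r13), blocks M, rc⟩
      ⟨99, regs (file cur mode m dep a r6 r7 r8 r9 r10 r11 r12 r13), blocks M, rc⟩ := by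
  refine .receive_none rfl rfl hX ?_
  exact .refl _

theorem Runs.stack_empty :
    Runs N X 1 []
      ⟨77, regs (file cur mode m dep a 0 r7 r8 r9 r10 r11 r12 r13), blocks M, rc⟩
      ⟨93, regs (file cur mode m dep a 0 r7 r8 r9 r10 r11 r12 r13), blocks M, rc⟩ := by
  refine .jumpEq_pos rfl rfl rfl ?_
  exact .refl _

theorem Runs.stack_smaller {y : ℕ} {x z : α} (hy : 0 < y) (hym : y ≤ m) (hrc : m < rc)
    (hm : 16 * (m + 2) + 15 < N) (hx : X[m]? = some x) (hz : X[y - 1]? = some z)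
    (hxz : ¬ x ≤ z) :
    Runs N X 4 []
      ⟨77, regs (file cur mode m dep a y r7 r8 r9 r10 r11 r12 r13), blocks M, rc⟩
      ⟨93, regs (file cur mode m dep a y (y - 1) r8 r9 r10 r11 r12 r13), blocks M, rc⟩ := by
  refine .jumpEq_neg rfl rfl (show ¬ y = 0 by omega) ?_
  refine .sub (v := y - 1) rfl rfl rfl rfl (by omega) ?_
  refine .jumpCharLe (x := x) (y := z) rfl rfl hrc (show y - 1 < rc by omega) hx hz ?_
  rw [if_neg hxz]
  refine .jump rfl rfl ?_
  exact .refl _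

/-- The character number `y - 1` is not smaller than the new one, and is removed from the stack;
its parent distance becomes `m - (y - 1)`. -/
theorem Runs.stack_pop {y y' : ℕ} {x z : α} (hy : 0 < y) (hym : y ≤ m) (hrc : m < rc)
    (hm : 16 * (m + 2) + 15 < N) (hx : X[m]? = some x) (hz : X[y - 1]? = some z)
    (hxz : x ≤ z) (hy' : M 9 (y + 1) = y') (hy'm : y' ≤ m) (ha : a ≤ m) :
    ∃ n r7' r8' r10', n ≤ 15 ∧ Runs N X n []
      ⟨77, regs (file cur mode m dep a y r7 r8 r9 r10 r11 r12 r13), blocks M, rc⟩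
      ⟨77, regs (file cur mode m dep (a + if m + 1 - y ≤ dep then 1 else 0) y' r7' r8' r9 r10'
        r11 r12 r13), blocks (put M 10 (y + 1) (m + 1 - y)), rc⟩ := by
  have key : ∀ n tr c', Runs N X n tr
      ⟨87, regs (file cur mode m dep a y (16 * (y + 1)) (m + 1 - y) r9 (16 * (y + 1) + 10)
        r11 r12 r13), blocks (put M 10 (y + 1) (m + 1 - y)), rc⟩ c' →
      Runs N X (n + 9) tr
      ⟨77, regs (file cur mode m dep a y r7 r8 r9 r10 r11 r12 r13), blocks M, rc⟩ c' := by
    intro n tr c' h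
    refine .jumpEq_neg rfl rfl (show ¬ y = 0 by omega) ?_
    refine .sub (v := y - 1) rfl rfl rfl rfl (by omega) ?_
    refine .jumpCharLe (x := x) (y := z) rfl rfl hrc (show y - 1 < rc by omega) hx hz ?_
    rw [if_pos hxz]
    refine .sub (v := m + 1 - y) rfl rfl rfl (show m - (y - 1) = m + 1 - y by omega) (by omega) ?_
    refine .add (v := y + 1) rfl rfl rfl rfl (by omega) ?_
    refine .mul (v := 16 * (y + 1)) rfl rfl rfl (Nat.mul_comm _ _) (by omega) ?_
    refine .const rfl rfl rfl (by omega) ?_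
    refine .add (v := 16 * (y + 1) + 10) rfl rfl rfl rfl (by omega) ?_
    refine .store (f := 10) (b := y + 1) (v := m + 1 - y) rfl rfl rfl (by omega) (by omega) rfl ?_
    exact h
  have last : ∀ a', Runs N X 4 []
      ⟨89, regs (file cur mode m dep a' y (16 * (y + 1)) (m + 1 - y) r9 (16 * (y + 1) + 10)
        r11 r12 r13), blocks (put M 10 (y + 1) (m + 1 - y)), rc⟩
      ⟨77, regs (file cur mode m dep a' y' (16 * (y + 1)) (m + 1 - y) r9 (16 * (y + 1) + 9)
        r11 r12 r13), blocks (put M 10 (y + 1) (m + 1 - y)), rc⟩ := by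
    intro a'
    refine .const rfl rfl rfl (by omega) ?_
    refine .add (v := 16 * (y + 1) + 9) rfl rfl rfl rfl (by omega) ?_
    refine .load (f := 9) (b := y + 1) (v := y') rfl rfl rfl rfl (by omega) (by omega)
      (by simpa [put] using hy') (by omega) ?_
    refine .jump rfl rfl ?_
    exact .refl _
  by_cases hd : m + 1 - y ≤ dep
  · rw [if_pos hd]
    refine ⟨_, 16 * (y + 1), m + 1 - y, 16 * (y + 1) + 9, le_rfl, key 6 [] _ ?_⟩
    refine .jumpLt_neg rfl rfl (show ¬ dep < m + 1 - y by omega) ?_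
    refine .add (v := a + 1) rfl rfl rfl rfl (by omega) ?_
    exact last (a + 1)
  · rw [if_neg hd]
    refine ⟨_, 16 * (y + 1), m + 1 - y, 16 * (y + 1) + 9, Nat.le_succ _, key 5 [] _ ?_⟩
    refine .jumpLt_pos rfl rfl (show dep < m + 1 - y by omega) ?_
    exact last a

theorem Runs.push {y : ℕ} (hm : 16 * (m + 2) + 15 < N) :
    ∃ r7' r8', Runs N X 6 []
      ⟨93, regs (file cur mode m dep a y r7 r8 r9 r10 r11 r12 r13), blocks M, rc⟩
      ⟨16, regs (file cur mode m dep a y r7' r8' r9 r10 r11 r12 r13),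
        blocks (put M 9 (m + 2) y), rc⟩ := by
  refine ⟨16 * (m + 2) + 9, 9, ?_⟩
  refine .add (v := m + 2) rfl rfl rfl rfl (by omega) ?_
  refine .mul (v := 16 * (m + 2)) rfl rfl rfl (Nat.mul_comm _ _) (by omega) ?_
  refine .const rfl rfl rfl (by omega) ?_
  refine .add (v := 16 * (m + 2) + 9) rfl rfl rfl rfl (by omega) ?_
  refine .store (f := 9) (b := m + 2) (v := y) rfl rfl rfl (by omega) (by omega) rfl ?_
  refine .jump rfl rfl ?_
  exact .refl _

end Pieces

/-! ### Digital search trees -/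

/-- Binary trees of blocks of the memory. -/
inductive SearchTree where
  | leaf
  | node (b : ℕ) (l r : SearchTree)

namespace SearchTree

/-- The blocks in a tree. -/
def support : SearchTree → List ℕ
  | leaf => []
  | node b l r => b :: (l.support ++ r.support)

/-- The tree is stored in the memory `M` under the pointer `p`. -/
def Stored (M : ℕ → ℕ → ℕ) : SearchTree → ℕ → Prop
  | leaf, p => p = 0
  | node b l r, p => p = 16 * b ∧ b ≠ 0 ∧ l.Stored M (M 6 b) ∧ r.Stored M (M 7 b)

/-- Digital search for the key `a`, of which the bits `k` are left: the binary digits of the key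
tell the way, and the search ends at a node with this key. -/
def find (key : ℕ → ℕ) (a : ℕ) : SearchTree → ℕ → Option ℕ
  | leaf, _ => none
  | node b l r, k =>
    if key b = a then some b
    else if k % 2 = 0 then l.find key a (k / 2) else r.find key a (k / 2)

/-- The cell and the block of the null pointer at which a failing search ends; `q` is the place of
the pointer to the tree. -/
def place : SearchTree → ℕ → ℕ × ℕ → ℕ × ℕ
  | leaf, _, q => q
  | node b l r, k, _ => if k % 2 = 0 then l.place (k / 2) (6, b) else r.place (k / 2) (7, b)

/-- Insert the block `c` at the end of a failing search. -/
def insert (c : ℕ) : SearchTree → ℕ → SearchTree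
  | leaf, _ => node c leaf leaf
  | node b l r, k =>
    if k % 2 = 0 then node b (l.insert c (k / 2)) r else node b l (r.insert c (k / 2))

/-- All keys are in digital order: `φ` prepends the digits that lead to the tree, and at most `L`
digits are left. -/
def Digital (key : ℕ → ℕ) : SearchTree → (ℕ → ℕ) → ℕ → Prop
  | leaf, _, _ => True
  | node b l r, φ, L => (∃ k < 2 ^ L, key b = φ k) ∧
      l.Digital key (fun k => φ (2 * k)) (L - 1) ∧ r.Digital key (fun k => φ (2 * k + 1)) (L - 1)

theorem half_lt {k L : ℕ} (h : k < 2 ^ (L + 1)) : k / 2 < 2 ^ L := by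
  rw [pow_succ] at h
  omega

theorem mem_support_insert {c k x : ℕ} {t : SearchTree} :
    x ∈ (t.insert c k).support ↔ x = c ∨ x ∈ t.support := by
  induction t generalizing k with
  | leaf => simp [insert, support]
  | node b l r ihl ihr =>
    simp only [insert]
    split_ifs
    · simp only [support, List.mem_cons, List.mem_append, ihl]
      tauto
    · simp only [support, List.mem_cons, List.mem_append, ihr]
      tauto

theorem nodup_insert {c k : ℕ} {t : SearchTree} (ht : t.support.Nodup) (hc : c ∉ t.support) :
    (t.insert c k).support.Nodup := by
  induction t generalizing k with
  | leaf => simp [insert, support]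
  | node b l r ihl ihr =>
    simp only [support, List.nodup_cons, List.nodup_append, List.mem_cons, List.mem_append,
      not_or] at ht hc
    obtain ⟨⟨hbl, hbr⟩, hl, hr, hlr⟩ := ht
    obtain ⟨hcb, hcl, hcr⟩ := hc
    simp only [insert]
    split_ifs
    · simp only [support, List.nodup_cons, List.nodup_append, List.mem_append, not_or,
        mem_support_insert]
      refine ⟨⟨⟨Ne.symm hcb, hbl⟩, hbr⟩, ihl hl hcl, hr, ?_⟩
      rintro x (rfl | hx) y hy
      · rintro rfl
        exact hcr hy
      · exact hlr x hx y hy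
    · simp only [support, List.nodup_cons, List.nodup_append, List.mem_append, not_or,
        mem_support_insert]
      refine ⟨⟨hbl, Ne.symm hcb, hbr⟩, hl, ihr hr hcr, ?_⟩
      rintro x hx y (rfl | hy)
      · rintro rfl
        exact hcl hx
      · exact hlr x hx y hy

theorem find_insert {key : ℕ → ℕ} {c a k : ℕ} {t : SearchTree} (hc : key c = a)
    (h : t.find key a k = none) (a' k' : ℕ) (hk : a' = a → k' = k) :
    (t.insert c k).find key a' k' = if a' = a then some c else t.find key a' k' := by
  induction t generalizing k k' with
  | leaf => by_cases h' : a = a' <;> simp [insert, find, hc, h', eq_comm]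
  | node b l r ihl ihr =>
    simp only [find] at h
    split_ifs at h with h1 h2
    · simp only [insert, h2, if_true, find]
      by_cases e : a' = a
      · obtain rfl := hk e
        subst e
        simp [h1, h2, ihl h (k' / 2) (fun _ => rfl)]
      · simp only [e, if_false]
        rw [ihl h (k' / 2) (fun h' => absurd h' e), if_neg e]
    · simp only [insert, h2, if_false, find]
      by_cases e : a' = a
      · obtain rfl := hk e
        subst e
        simp [h1, h2, ihr h (k' / 2) (fun _ => rfl)]
      · simp only [e, if_false]
        rw [ihr h (k' / 2) (fun h' => absurd h' e), if_neg e]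

theorem mem_support_of_find {key : ℕ → ℕ} {a k b : ℕ} {t : SearchTree}
    (h : t.find key a k = some b) : b ∈ t.support ∧ key b = a := by
  induction t generalizing k with
  | leaf => simp [find] at h
  | node c l r ihl ihr =>
    simp only [find] at h
    split_ifs at h with h1 h2
    · obtain rfl := Option.some_inj.1 h
      exact ⟨by simp [support], h1⟩
    · exact ⟨by simp [support, (ihl h).1], (ihl h).2⟩
    · exact ⟨by simp [support, (ihr h).1], (ihr h).2⟩

theorem Digital.insert {key : ℕ → ℕ} {c a k L : ℕ} {t : SearchTree} {φ : ℕ → ℕ}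
    (ht : t.Digital key φ L) (hc : key c = a) (ha : a = φ k) (hk : k < 2 ^ L)
    (h : t.find key a k = none) : (t.insert c k).Digital key φ L := by
  induction t generalizing k L φ with
  | leaf => exact ⟨⟨k, hk, hc.trans ha⟩, trivial, trivial⟩
  | node b l r ihl ihr =>
    obtain ⟨⟨k0, hk0, hb⟩, hl, hr⟩ := ht
    simp only [find] at h
    split_ifs at h with h1 h2
    all_goals
      rcases L with _ | L
      · obtain rfl : k = 0 := by simpa using hk
        obtain rfl : k0 = 0 := by simpa using hk0
        exact absurd (hb.trans ha.symm) h1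
    · simp only [SearchTree.insert, h2, if_true]
      refine ⟨⟨k0, hk0, hb⟩, ihl hl ?_ (half_lt hk) h, hr⟩
      rw [ha]
      congr 1
      omega
    · simp only [SearchTree.insert, h2, if_false]
      refine ⟨⟨k0, hk0, hb⟩, hl, ihr hr ?_ (half_lt hk) h⟩
      rw [ha]
      congr 1
      omega

theorem Digital.congr {key key' : ℕ → ℕ} {L : ℕ} {t : SearchTree} {φ : ℕ → ℕ}
    (ht : t.Digital key φ L) (h : ∀ b ∈ t.support, key' b = key b) : t.Digital key' φ L := by
  induction t generalizing L φ with
  | leaf => trivial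
  | node b l r ihl ihr =>
    obtain ⟨⟨k, hk, hb⟩, hl, hr⟩ := ht
    exact ⟨⟨k, hk, (h b (by simp [support])).trans hb⟩,
      ihl hl fun x hx => h x (by simp [support, hx]), ihr hr fun x hx => h x (by simp [support, hx])⟩

theorem find_congr {key key' : ℕ → ℕ} {t : SearchTree} (h : ∀ b ∈ t.support, key' b = key b)
    (a k : ℕ) : t.find key' a k = t.find key a k := by
  induction t generalizing k with
  | leaf => rfl
  | node b l r ihl ihr =>
    simp only [find]
    rw [h b (by simp [support]), ihl fun x hx => h x (by simp [support, hx]),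
      ihr fun x hx => h x (by simp [support, hx])]

theorem Stored.congr {M M' : ℕ → ℕ → ℕ} {t : SearchTree} {p : ℕ} (ht : t.Stored M p)
    (h : ∀ b ∈ t.support, M' 6 b = M 6 b ∧ M' 7 b = M 7 b) : t.Stored M' p := by
  induction t generalizing p with
  | leaf => exact ht
  | node b l r ihl ihr =>
    obtain ⟨h1, h2, hl, hr⟩ := ht
    obtain ⟨e6, e7⟩ := h b (by simp [support])
    refine ⟨h1, h2, ?_, ?_⟩
    · rw [e6]
      exact ihl hl fun x hx => h x (by simp [support, hx])
    · rw [e7]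
      exact ihr hr fun x hx => h x (by simp [support, hx])

theorem place_eq_or (t : SearchTree) (k : ℕ) (q : ℕ × ℕ) :
    t.place k q = q ∨ ((t.place k q).1 = 6 ∨ (t.place k q).1 = 7) ∧ (t.place k q).2 ∈ t.support := by
  induction t generalizing k q with
  | leaf => exact Or.inl rfl
  | node b l r ihl ihr =>
    right
    simp only [place]
    split_ifs
    · rcases ihl (k / 2) (6, b) with h | ⟨h, h'⟩
      · simp [h, support]
      · exact ⟨h, by simp [support, h']⟩
    · rcases ihr (k / 2) (7, b) with h | ⟨h, h'⟩
      · simp [h, support]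
      · exact ⟨h, by simp [support, h']⟩

/-- Writing the address of the new block to the place where the search has failed inserts it into
the stored tree. -/
theorem Stored.insert {M : ℕ → ℕ → ℕ} {t : SearchTree} {c k f b : ℕ} (ht : t.Stored M (M f b))
    (hnd : t.support.Nodup) (hq : ¬ ((f = 6 ∨ f = 7) ∧ b ∈ t.support)) (hc0 : c ≠ 0)
    (hc : c ∉ t.support) (h6 : M 6 c = 0) (h7 : M 7 c = 0) (hb : ¬ ((f = 6 ∨ f = 7) ∧ b = c)) :
    let q := t.place k (f, b)
    let M' := put M q.1 q.2 (16 * c)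
    (t.insert c k).Stored M' (M' f b) := by
  induction t generalizing k f b with
  | leaf =>
    simp only [place, SearchTree.insert, Stored, put, and_self, if_true, true_and]
    refine ⟨hc0, ?_, ?_⟩
    · rwa [if_neg]
      rintro ⟨rfl, rfl⟩
      exact hb (by simp)
    · rwa [if_neg]
      rintro ⟨rfl, rfl⟩
      exact hb (by simp)
  | node d l r ihl ihr =>
    obtain ⟨h1, h2, hl, hr⟩ := ht
    simp only [support, List.nodup_cons, List.nodup_append, List.mem_cons, List.mem_append,
      not_or] at hnd hc hq
    obtain ⟨⟨hdl, hdr⟩, hndl, hndr, hlr⟩ := hnd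
    obtain ⟨hcd, hcl, hcr⟩ := hc
    intro q M'
    have hqc : (q.1 = 6 ∨ q.1 = 7) ∧ (q.2 = d ∨ q.2 ∈ l.support ∨ q.2 ∈ r.support) := by
      simp only [q, place]
      split_ifs
      · rcases place_eq_or l (k / 2) (6, d) with h | ⟨h, h'⟩
        · simp [h]
        · exact ⟨h, Or.inr (Or.inl h')⟩
      · rcases place_eq_or r (k / 2) (7, d) with h | ⟨h, h'⟩
        · simp [h]
        · exact ⟨h, Or.inr (Or.inr h')⟩
    have hfb : M' f b = M f b := by
      simp only [M', put]
      rw [if_neg]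
      rintro ⟨e, e'⟩
      rw [e, e'] at hq
      exact hq hqc
    rw [hfb]
    simp only [SearchTree.insert]
    by_cases hk : k % 2 = 0
    · rw [if_pos hk]
      refine ⟨h1, h2, ?_, ?_⟩
      · have := ihl (k := k / 2) hl hndl (by simp [hdl]) hcl (by simp [Ne.symm hcd])
        simpa [M', q, place, hk] using this
      · have hq' : ∀ x, x = d ∨ x ∈ r.support → ∀ g, (x = d → g ≠ 6) → M' g x = M g x := by
          intro x hx g hg
          simp only [M', put]
          rw [if_neg]
          rintro ⟨hg1, hx1⟩
          have := place_eq_or l (k / 2) (6, d)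
          simp only [q, place, hk, if_true] at hg1 hx1
          rcases this with h | ⟨-, h⟩
          · rw [h] at hg1 hx1
            exact hg hx1 hg1
          · rw [← hx1] at h
            rcases hx with rfl | hx
            · exact hdl h
            · exact hlr x h x hx rfl
        rw [hq' d (Or.inl rfl) 7 (by simp)]
        refine hr.congr fun x hx => ⟨hq' x (Or.inr hx) 6 ?_, hq' x (Or.inr hx) 7 (by simp)⟩
        rintro rfl
        exact absurd hx hdr
    · rw [if_neg hk]
      refine ⟨h1, h2, ?_, ?_⟩
      · have hq' : ∀ x, x = d ∨ x ∈ l.support → ∀ g, (x = d → g ≠ 7) → M' g x = M g x := by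
          intro x hx g hg
          simp only [M', put]
          rw [if_neg]
          rintro ⟨hg1, hx1⟩
          have := place_eq_or r (k / 2) (7, d)
          simp only [q, place, hk, if_false] at hg1 hx1
          rcases this with h | ⟨-, h⟩
          · rw [h] at hg1 hx1
            exact hg hx1 hg1
          · rw [← hx1] at h
            rcases hx with rfl | hx
            · exact hdr h
            · exact hlr x hx x h rfl
        rw [hq' d (Or.inl rfl) 6 (by simp)]
        refine hl.congr fun x hx => ⟨hq' x (Or.inr hx) 6 (by simp), hq' x (Or.inr hx) 7 ?_⟩
        rintro rfl
        exact absurd hx hdl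
      · have := ihr (k := k / 2) hr hndr (by simp [hdr]) hcr (by simp [Ne.symm hcd])
        simpa [M', q, place, hk] using this

end SearchTree

section Search

variable {α : Type*} [LinearOrder α] {N : ℕ} {X : List α} {M : ℕ → ℕ → ℕ}
  {cur mode m dep a r6 r7 r8 r11 r12 r13 rc : ℕ}

open SearchTree

/-- A successful run of the search loop; its time is proportional to the number of digits. -/
theorem Runs.search_some {t : SearchTree} {φ : ℕ → ℕ} {L k f b w : ℕ} (ht : t.Stored M (M f b))
    (hd : t.Digital (M 5) φ L) (hN : ∀ w ∈ t.support, 16 * w + 15 < N ∧ M 5 w < N)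
    (ha : a = φ k) (hkL : k < 2 ^ L) (haN : a < N) (hkN : k < N) (hf : f < 16)
    (hb : 16 * b + f < N) (hw : t.find (M 5) a k = some w) :
    ∃ n r7' r8' r9' r10', n ≤ 14 * L + 6 ∧
      Runs N X n []
        ⟨19, regs (file cur mode m dep a r6 r7 r8 (16 * b + f) k r11 r12 r13), blocks M, rc⟩
        ⟨47, regs (file cur mode m dep a (16 * w) r7' r8' r9' r10' r11 r12 r13),
          blocks M, rc⟩ := by
  induction t generalizing φ L k f b r6 r7 r8 with
  | leaf => simp [find] at hw
  | node c l r ihl ihr =>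
    obtain ⟨hp, hc0, hl, hr⟩ := ht
    obtain ⟨⟨k0, hk0, hkey⟩, hdl, hdr⟩ := hd
    obtain ⟨hcN, hkeyN⟩ := hN c (by simp [support])
    simp only [find] at hw
    split_ifs at hw with h1 h2
    · obtain rfl := Option.some_inj.1 hw
      exact ⟨6, _, _, _, _, by omega, Runs.search_found hf hb hp hc0 hcN h1 haN⟩
    all_goals
      rcases L with _ | L
      · obtain rfl : k = 0 := by simpa using hkL
        obtain rfl : k0 = 0 := by simpa using hk0
        exact absurd (hkey.trans ha.symm) h1
      have hnext := Runs.search_next (X := X) (cur := cur) (mode := mode) (m := m) (dep := dep)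
        (r6 := r6) (r7 := r7) (r8 := r8) (r11 := r11) (r12 := r12) (r13 := r13) (rc := rc)
        hf hb hp hc0 hcN h1 hkeyN hkN
    · rw [h2] at hnext
      obtain ⟨n, r7', r8', r9', r10', hn, h⟩ := ihl (φ := fun k => φ (2 * k)) (L := L)
        (k := k / 2) (f := 6) (b := c) (r6 := 16 * c) (r7 := 6) (r8 := 0) hl hdl
        (fun w hw => hN w (by simp [support, hw])) (by rw [ha]; congr 1; omega) (half_lt hkL)
        (by omega) (by omega) (by omega) hw
      exact ⟨14 + n, _, _, _, _, by omega, hnext.trans h⟩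
    · have h2' : k % 2 = 1 := by omega
      rw [h2'] at hnext
      obtain ⟨n, r7', r8', r9', r10', hn, h⟩ := ihr (φ := fun k => φ (2 * k + 1)) (L := L)
        (k := k / 2) (f := 7) (b := c) (r6 := 16 * c) (r7 := 6) (r8 := 1) hr hdr
        (fun w hw => hN w (by simp [support, hw])) (by rw [ha]; congr 1; omega) (half_lt hkL)
        (by omega) (by omega) (by omega) hw
      exact ⟨14 + n, _, _, _, _, by omega, hnext.trans h⟩

/-- A failing run of the search loop, which ends with the place of the missing pointer in
register `9`. -/
theorem Runs.search_none {t : SearchTree} {φ : ℕ → ℕ} {L k f b : ℕ} (ht : t.Stored M (M f b))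
    (hd : t.Digital (M 5) φ L) (hN : ∀ w ∈ t.support, 16 * w + 15 < N ∧ M 5 w < N)
    (ha : a = φ k) (hkL : k < 2 ^ L) (hkN : k < N) (hf : f < 16)
    (hb : 16 * b + f < N) (hw : t.find (M 5) a k = none) :
    ∃ n r7' r8' r10', n ≤ 14 * L + 6 ∧
      Runs N X n []
        ⟨19, regs (file cur mode m dep a r6 r7 r8 (16 * b + f) k r11 r12 r13), blocks M, rc⟩
        ⟨33, regs (file cur mode m dep a 0 r7' r8'
          (16 * (t.place k (f, b)).2 + (t.place k (f, b)).1) r10' r11 r12 r13),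
          blocks M, rc⟩ := by
  induction t generalizing φ L k f b r6 r7 r8 with
  | leaf => exact ⟨2, _, _, _, by omega, Runs.search_empty hf hb ht⟩
  | node c l r ihl ihr =>
    obtain ⟨hp, hc0, hl, hr⟩ := ht
    obtain ⟨⟨k0, hk0, hkey⟩, hdl, hdr⟩ := hd
    obtain ⟨hcN, hkeyN⟩ := hN c (by simp [support])
    simp only [find] at hw
    split_ifs at hw with h1 h2
    all_goals
      rcases L with _ | L
      · obtain rfl : k = 0 := by simpa using hkL
        obtain rfl : k0 = 0 := by simpa using hk0
        exact absurd (hkey.trans ha.symm) h1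
      have hnext := Runs.search_next (X := X) (cur := cur) (mode := mode) (m := m) (dep := dep)
        (r6 := r6) (r7 := r7) (r8 := r8) (r11 := r11) (r12 := r12) (r13 := r13) (rc := rc)
        hf hb hp hc0 hcN h1 hkeyN hkN
      simp only [place, h2, if_true, if_false]
    · rw [h2] at hnext
      obtain ⟨n, r7', r8', r10', hn, h⟩ := ihl (φ := fun k => φ (2 * k)) (L := L)
        (k := k / 2) (f := 6) (b := c) (r6 := 16 * c) (r7 := 6) (r8 := 0) hl hdl
        (fun w hw => hN w (by simp [support, hw])) (by rw [ha]; congr 1; omega) (half_lt hkL)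
        (by omega) (by omega) (by omega) hw
      exact ⟨14 + n, _, _, _, by omega, hnext.trans h⟩
    · have h2' : k % 2 = 1 := by omega
      rw [h2'] at hnext
      obtain ⟨n, r7', r8', r10', hn, h⟩ := ihr (φ := fun k => φ (2 * k + 1)) (L := L)
        (k := k / 2) (f := 7) (b := c) (r6 := 16 * c) (r7 := 6) (r8 := 1) hr hdr
        (fun w hw => hN w (by simp [support, hw])) (by rw [ha]; congr 1; omega) (half_lt hkL)
        (by omega) (by omega) (by omega) hw
      exact ⟨14 + n, _, _, _, by omega, hnext.trans h⟩

end Search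

/-! ### The stack of the positions without parent -/

theorem takeWhile_eq_filter {β : Type*} (p : β → Bool) {l : List β}
    (h : l.Pairwise fun a b => p b = true → p a = true) :
    l.takeWhile p = l.filter p ∧ l.dropWhile p = l.filter fun b => !p b := by
  induction l with
  | nil => simp
  | cons a l ih =>
    rw [List.pairwise_cons] at h
    obtain ⟨ih1, ih2⟩ := ih h.2
    by_cases ha : p a
    · simp [ha, ih1, ih2]
    · have : ∀ b ∈ l, ¬ p b = true := fun b hb hpb => ha (h.1 b hb hpb)
      simp only [Bool.not_eq_true] at ha this
      simp only [List.takeWhile_cons, List.dropWhile_cons, List.filter_cons, ha]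
      refine ⟨by simpa using this, ?_⟩
      simp only [Bool.false_eq_true, if_false, Bool.not_false, if_true, List.cons.injEq, true_and]
      exact (List.filter_eq_self.2 fun b hb => by simp [this b hb]).symm

/-- The list `Z` is stored as a linked list in the cells `9`, from the pointer `p` on. The
character received as number `y - 1` is represented by `y`, and `0` is the null pointer. -/
def Chained (M : ℕ → ℕ → ℕ) : List ℕ → ℕ → Prop
  | [], p => p = 0
  | y :: Z, p => p = y ∧ Chained M Z (M 9 (y + 1))

theorem Chained.congr {M M' : ℕ → ℕ → ℕ} {Z : List ℕ} {p : ℕ} (h : Chained M Z p)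
    (hM : ∀ y ∈ Z, M' 9 (y + 1) = M 9 (y + 1)) : Chained M' Z p := by
  induction Z generalizing p with
  | nil => exact h
  | cons y Z ih =>
    refine ⟨h.1, ?_⟩
    rw [hM y (by simp)]
    exact ih h.2 fun z hz => hM z (by simp [hz])

/-- The memory after the characters in `W` have received the character number `m` as parent. -/
def popBlocks (M : ℕ → ℕ → ℕ) (m : ℕ) (W : List ℕ) : ℕ → ℕ → ℕ :=
  W.foldl (fun M y => put M 10 (y + 1) (m + 1 - y)) M

theorem popBlocks_apply (M : ℕ → ℕ → ℕ) (m : ℕ) (W : List ℕ) (g b : ℕ) :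
    popBlocks M m W g b = if g = 10 ∧ 1 ≤ b ∧ b - 1 ∈ W then m + 2 - b else M g b := by
  induction W generalizing M with
  | nil => simp [popBlocks]
  | cons y W ih =>
    have : popBlocks M m (y :: W) = popBlocks (put M 10 (y + 1) (m + 1 - y)) m W := rfl
    rw [this, ih]
    by_cases hg : g = 10
    · subst hg
      by_cases hW : 1 ≤ b ∧ b - 1 ∈ W
      · rw [if_pos ⟨rfl, hW⟩, if_pos ⟨rfl, hW.1, by simp [hW.2]⟩]
      · rw [if_neg (by simpa using hW)]
        by_cases hb : b = y + 1
        · subst hb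
          simp only [put, and_self, if_true]
          rw [if_pos ⟨trivial, by omega, by simp⟩]
          omega
        · rw [if_neg]
          · simp [put, hb]
          · rintro ⟨-, h1, h2⟩
            rcases List.mem_cons.1 h2 with h2 | h2
            · omega
            · exact hW ⟨h1, h2⟩
    · simp [hg, put]

section Pops

variable {α : Type*} [LinearOrder α] {N : ℕ} {X : List α} {M : ℕ → ℕ → ℕ}
  {cur mode m dep a r6 r7 r8 r9 r10 r11 r12 r13 rc : ℕ}

/-- The pop loop: the characters on top of the stack that are not smaller than the new one are
removed, and those in front of the position `dep + 1` are counted. -/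
theorem Runs.pop_loop {x : α} (p : ℕ → Bool) {Z : List ℕ} {y : ℕ} (hZ : Chained M Z y)
    (hp : ∀ y ∈ Z, ∃ z, X[y - 1]? = some z ∧ (p y = true ↔ x ≤ z))
    (hZm : ∀ y ∈ Z, 0 < y ∧ y ≤ m) (hrc : m < rc) (hm : 16 * (m + 2) + 15 < N)
    (hx : X[m]? = some x) (ha : a + Z.length ≤ m + 1) :
    ∃ n r7' r8' r10', n ≤ 15 * (Z.takeWhile p).length + 4 ∧ Runs N X n []
      ⟨77, regs (file cur mode m dep a y r7 r8 r9 r10 r11 r12 r13), blocks M, rc⟩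
      ⟨93, regs (file cur mode m dep (a + (Z.takeWhile p).countP fun y => m + 1 - y ≤ dep)
        ((Z.dropWhile p).headD 0) r7' r8' r9 r10' r11 r12 r13),
        blocks (popBlocks M m (Z.takeWhile p)), rc⟩ := by
  induction Z generalizing M y a r7 r8 r10 with
  | nil =>
    obtain rfl : y = 0 := hZ
    exact ⟨1, _, _, _, by simp, Runs.stack_empty⟩
  | cons w Z ih =>
    obtain ⟨rfl, hZ⟩ := hZ
    obtain ⟨z, hz, hpz⟩ := hp y (by simp)
    obtain ⟨hy0, hym⟩ := hZm y (by simp)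
    by_cases hxz : x ≤ z
    · have hpy : p y = true := hpz.2 hxz
      have hy'm : M 9 (y + 1) ≤ m := by
        rcases Z with _ | ⟨w, Z⟩
        · have : M 9 (y + 1) = 0 := hZ
          omega
        · rw [hZ.1]
          exact (hZm w (by simp)).2
      simp only [List.length_cons] at ha
      obtain ⟨n, r7', r8', r10', hn, h⟩ := Runs.stack_pop (X := X) (cur := cur) (mode := mode)
        (dep := dep) (r7 := r7) (r8 := r8) (r9 := r9) (r10 := r10) (r11 := r11) (r12 := r12)
        (r13 := r13) hy0 hym hrc hm hx hz hxz rfl hy'm (a := a) (by omega)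
      obtain ⟨n', r7'', r8'', r10'', hn', h'⟩ := ih (M := put M 10 (y + 1) (m + 1 - y))
        (y := M 9 (y + 1)) (a := a + if m + 1 - y ≤ dep then 1 else 0) (r7 := r7') (r8 := r8')
        (r10 := r10') (hZ.congr fun w _ => by simp [put]) (fun w hw => hp w (by simp [hw]))
        (fun w hw => hZm w (by simp [hw])) (by split_ifs <;> omega)
      refine ⟨n + n', r7'', r8'', r10'', ?_, ?_⟩
      · simp only [List.takeWhile_cons, hpy, if_true, List.length_cons]
        omega
      · refine (h.trans h').cast rfl ?_
        have e : a + (if m + 1 - y ≤ dep then 1 else 0) +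
              (Z.takeWhile p).countP (fun y => m + 1 - y ≤ dep) =
            a + ((y :: Z).takeWhile p).countP (fun y => m + 1 - y ≤ dep) := by
          simp only [List.takeWhile_cons, hpy, if_true, List.countP_cons, decide_eq_true_eq]
          omega
        have e2 : popBlocks (put M 10 (y + 1) (m + 1 - y)) m (Z.takeWhile p) =
            popBlocks M m ((y :: Z).takeWhile p) := by
          simp only [List.takeWhile_cons, hpy, if_true]
          rfl
        rw [e, e2]
        simp only [List.dropWhile_cons, hpy, if_true]
    · have hpy : p y = false := by rwa [← Bool.not_eq_true, hpz]
      refine ⟨4, y - 1, r8, r10, by simp, (Runs.stack_smaller hy0 hym hrc hm hx hz hxz).cast rfl ?_⟩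
      simp [hpy, popBlocks]

end Pops

section Stack

variable {α : Type*} [LinearOrder α]

/-- The part of the memory that depends only on the string `s` processed so far: the parent
distances, and the stack `Z` of the positions without parent. -/
structure StringInv (s : List α) (M : ℕ → ℕ → ℕ) (Z : List ℕ) : Prop where
  sorted : Z.Pairwise (· > ·)
  mem_iff : ∀ y, y ∈ Z ↔ 1 ≤ y ∧ y ≤ s.length ∧ (pd s)[s.length - y]? = some 0
  chained : Chained M Z s.length
  dist : ∀ y, 1 ≤ y → y ≤ s.length → (pd s)[s.length - y]? = some (M 10 (y + 1))

theorem getElem?_pd_cons (x : α) (s : List α) {y : ℕ} (hy1 : 1 ≤ y) (hy : y ≤ s.length) :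
    (pd (x :: s))[s.length + 1 - y]? =
      some (if (pd s)[s.length - y]'(by simp; omega) = 0 ∧ x ≤ s[s.length - y] then
        s.length + 1 - y else (pd s)[s.length - y]'(by simp; omega)) := by
  have e : s.length + 1 - y = s.length - y + 1 := by omega
  rw [e, List.getElem?_eq_getElem (by simp; omega), pd_cons_succ x s _ (by omega)]

/-- The stack of the positions that stay without parent when `x` is put in front of `s`. -/
theorem StringInv.step {s : List α} {M : ℕ → ℕ → ℕ} {Z : List ℕ} (h : StringInv s M Z) (x : α)
    (p : ℕ → Bool) (hp : ∀ y (h1 : 1 ≤ y) (h2 : y ≤ s.length), p y = true ↔ x ≤ s[s.length - y])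
    (hM : M 10 (s.length + 2) = 0) :
    StringInv (x :: s)
      (put (popBlocks M s.length (Z.takeWhile p)) 9 (s.length + 2) ((Z.dropWhile p).headD 0))
      ((s.length + 1) :: Z.dropWhile p) ∧
    ∀ dep, (Z.takeWhile p).countP (fun y => s.length + 1 - y ≤ dep) =
      (frontPointers ((pd (x :: s)).take (dep + 1))).card := by
  have hzero : ∀ y (h1 : 1 ≤ y) (h2 : y ≤ s.length),
      y ∈ Z ↔ (pd s)[s.length - y]'(by simp; omega) = 0 := by
    intro y h1 h2
    rw [h.mem_iff, List.getElem?_eq_getElem (by simp; omega)]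
    simp [h1, h2]
  have hpair : Z.Pairwise fun y y' => p y' = true → p y = true := by
    refine List.Pairwise.imp_of_mem (R := (· > ·)) ?_ h.sorted
    intro y y' hy hy' hgt hpy'
    obtain ⟨h1, h2, -⟩ := (h.mem_iff y).1 hy
    obtain ⟨h1', h2', -⟩ := (h.mem_iff y').1 hy'
    rw [hp y h1 h2]
    rw [hp y' h1' h2'] at hpy'
    exact hpy'.trans (getElem_lt_of_pd_eq_zero s (by omega) (by omega)
      ((hzero y' h1' h2').1 hy')).le
  obtain ⟨et, ed⟩ := takeWhile_eq_filter p hpair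
  have hle : ∀ y ∈ Z, 1 ≤ y ∧ y ≤ s.length := fun y hy =>
    ⟨((h.mem_iff y).1 hy).1, ((h.mem_iff y).1 hy).2.1⟩
  refine ⟨⟨?_, ?_, ?_, ?_⟩, ?_⟩
  · rw [List.pairwise_cons, ed]
    refine ⟨fun y hy => ?_, h.sorted.filter _⟩
    have := hle y (List.mem_of_mem_filter hy)
    omega
  · intro y
    rw [List.mem_cons, ed, List.mem_filter, List.length_cons]
    constructor
    · rintro (rfl | ⟨hy, hpy⟩)
      · simp [pd_cons_zero]
      · obtain ⟨h1, h2⟩ := hle y hy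
        refine ⟨h1, by omega, ?_⟩
        rw [getElem?_pd_cons x s h1 h2, if_neg, (hzero y h1 h2).1 hy]
        rintro ⟨-, hx⟩
        simp [(hp y h1 h2).2 hx] at hpy
    · rintro ⟨h1, h2, h3⟩
      by_cases hy : y = s.length + 1
      · exact Or.inl hy
      · rw [getElem?_pd_cons x s h1 (by omega), Option.some_inj] at h3
        split_ifs at h3 with hc
        · omega
        · refine Or.inr ⟨(hzero y h1 (by omega)).2 h3, ?_⟩
          have : ¬ p y = true := fun hpy => hc ⟨h3, (hp y h1 (by omega)).1 hpy⟩
          simpa using this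
  · refine ⟨rfl, ?_⟩
    have hc : ∀ (Z : List ℕ) y, Chained M Z y →
        Chained M (Z.dropWhile p) ((Z.dropWhile p).headD 0) := by
      intro Z
      induction Z with
      | nil => intro y hy; rfl
      | cons w Z ih =>
        rintro y ⟨rfl, hy⟩
        by_cases hpy : p y
        · simpa [hpy] using ih _ hy
        · simpa [hpy] using ⟨rfl, hy⟩
    have e : put (popBlocks M s.length (Z.takeWhile p)) 9 (s.length + 2)
        ((Z.dropWhile p).headD 0) 9 (s.length + 1 + 1) = (Z.dropWhile p).headD 0 := by
      simp [put]
    rw [e]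
    refine (hc Z _ h.chained).congr fun y hy => ?_
    rw [ed] at hy
    have := hle y (List.mem_of_mem_filter hy)
    simp only [put, popBlocks_apply]
    rw [if_neg (by omega), if_neg (by omega)]
  · intro y h1 h2
    simp only [put, popBlocks_apply]
    rw [if_neg (by omega)]
    simp only [List.length_cons] at h2 ⊢
    by_cases hy : y = s.length + 1
    · subst hy
      rw [if_neg]
      · simp [pd_cons_zero, hM]
      · rintro ⟨-, -, hmem⟩
        rw [et] at hmem
        have := hle _ (List.mem_of_mem_filter hmem)
        omega
    · rw [getElem?_pd_cons x s h1 (by omega)]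
      have hd := h.dist y h1 (by omega)
      rw [List.getElem?_eq_getElem (by simp; omega), Option.some_inj] at hd
      simp only [true_and, Nat.add_sub_cancel, et, List.mem_filter, hzero y h1 (by omega),
        hp y h1 (by omega), show 1 ≤ y + 1 by omega]
      split_ifs
      · congr 1
        omega
      · rw [hd]
  · intro dep
    rw [List.countP_eq_length_filter, et, List.filter_filter]
    set F := Z.filter fun y => decide (s.length + 1 - y ≤ dep) && p y with hF
    have hnd : F.Nodup := ((h.sorted.imp (fun hab => ne_of_gt hab) : Z.Nodup)).filter _
    have hFle : ∀ y ∈ F, 1 ≤ y ∧ y ≤ s.length := fun y hy => hle y (List.mem_of_mem_filter hy)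
    have hset : frontPointers ((pd (x :: s)).take (dep + 1)) =
        F.toFinset.image (fun y => s.length + 1 - y) := by
      ext q
      rw [Finset.mem_image]
      simp only [List.mem_toFinset]
      constructor
      · intro hq
        rw [mem_frontPointers, List.getElem?_take] at hq
        obtain ⟨hq1, hq2⟩ := hq
        split_ifs at hq2 with hqd
        obtain ⟨q, rfl⟩ : ∃ k, q = k + 1 := ⟨q - 1, by omega⟩
        have hq : q + 1 ∈ frontPointers (pd (x :: s)) := mem_frontPointers.2 ⟨hq1, hq2⟩
        rw [succ_mem_frontPointers_pd_cons] at hq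
        obtain ⟨hqs, hq0, hx⟩ := hq
        have e : s.length - (s.length - q) = q := by omega
        refine ⟨s.length - q, ?_, by omega⟩
        rw [hF, List.mem_filter, hzero _ (by omega) (by omega), Bool.and_eq_true, decide_eq_true_eq,
          hp _ (by omega) (by omega)]
        simp only [e]
        exact ⟨hq0, by omega, hx⟩
      · rintro ⟨y, hy, rfl⟩
        obtain ⟨h1, h2⟩ := hFle y hy
        rw [hF, List.mem_filter, Bool.and_eq_true, decide_eq_true_eq, hp y h1 h2,
          hzero y h1 h2] at hy
        rw [mem_frontPointers, List.getElem?_take, if_pos (by omega), getElem?_pd_cons x s h1 h2,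
          if_pos ⟨hy.1, hy.2.2⟩]
        exact ⟨by omega, rfl⟩
    rw [hset, Finset.card_image_of_injOn, List.toFinset_card_of_nodup hnd]
    intro y hy z hz hyz
    have hy := hFle y (by simpa using hy)
    have hz := hFle z (by simpa using hz)
    simp only at hyz
    omega

variable {N : ℕ} {X : List α} {cur mode dep a r6 r7 r8 r9 r10 r11 r12 r13 : ℕ}

/-- The machine receives the new character `x` and updates the parent distances; the label in
register `5` is then the one that belongs to the node created last. -/
theorem Runs.receive_and_pop {s : List α} {M : ℕ → ℕ → ℕ} {Z : List ℕ} (h : StringInv s M Z)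
    (x : α) (hX : ∀ k ≤ s.length, X[k]? = (x :: s).reverse[k]?)
    (hN : 16 * (s.length + 2) + 15 < N) (hM : M 10 (s.length + 2) = 0) :
    ∃ n M' Z' r6' r7' r8' r10', n + 15 * Z'.length ≤ 15 * Z.length + 29 ∧
      StringInv (x :: s) M' Z' ∧
      (∀ g b, (g ≠ 9 ∧ g ≠ 10) ∨ s.length + 2 < b → M' g b = M g b) ∧
      Runs N X n []
        ⟨73, regs (file cur mode s.length dep a r6 r7 r8 r9 r10 r11 r12 r13), blocks M, s.length⟩
        ⟨16, regs (file cur 1 s.length dep (frontPointers ((pd (x :: s)).take (dep + 1))).card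
          r6' r7' r8' r9 r10' r11 r12 r13), blocks M', s.length + 1⟩ := by
  have hXm : X[s.length]? = some x := by rw [hX _ le_rfl]; simp
  have hXy : ∀ y (h1 : 1 ≤ y) (h2 : y ≤ s.length), X[y - 1]? = some s[s.length - y] := by
    intro y h1 h2
    rw [hX _ (by omega), List.reverse_cons, List.getElem?_append_left (by simp; omega),
      List.getElem?_reverse (by omega), ← List.getElem?_eq_getElem]
    congr 1
    omega
  have hlen : s.length < X.length := (List.getElem?_eq_some_iff.1 hXm).1
  let p : ℕ → Bool := fun y => (s[s.length - y]?).any fun z => decide (x ≤ z)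
  have hp : ∀ y (h1 : 1 ≤ y) (h2 : y ≤ s.length), p y = true ↔ x ≤ s[s.length - y] := by
    intro y h1 h2
    simp only [p]
    rw [List.getElem?_eq_getElem (by omega)]
    simp
  obtain ⟨hinv, hcount⟩ := h.step x p hp hM
  have hZ : ∀ y ∈ Z, 0 < y ∧ y ≤ s.length := fun y hy =>
    ⟨((h.mem_iff y).1 hy).1, ((h.mem_iff y).1 hy).2.1⟩
  have hZlen : Z.length ≤ s.length := by
    have hnd : Z.Nodup := h.sorted.imp (fun hab => ne_of_gt hab)
    have := Finset.card_le_card (s := Z.toFinset) (t := Finset.Icc 1 s.length) (by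
      intro y hy
      simpa [Nat.succ_le_iff] using hZ y (by simpa using hy))
    rwa [List.toFinset_card_of_nodup hnd, Nat.card_Icc, Nat.add_sub_cancel] at this
  have h1 := Runs.next_char (X := X) (cur := cur) (mode := mode) (dep := dep) (a := a)
    (r6 := r6) (r7 := r7) (r8 := r8) (r9 := r9) (r10 := r10) (r11 := r11) (r12 := r12)
    (r13 := r13) (M := M) hlen hN
  obtain ⟨n2, r7', r8', r10', hn2, h2⟩ := Runs.pop_loop (X := X) (N := N) (cur := cur) (mode := 1)
    (m := s.length) (dep := dep) (a := 0) (r7 := r7) (r8 := r8) (r9 := r9) (r10 := r10)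
    (r11 := r11) (r12 := r12) (r13 := r13) (rc := s.length + 1) p h.chained
    (fun y hy => ⟨_, hXy y (hZ y hy).1 (hZ y hy).2, hp y (hZ y hy).1 (hZ y hy).2⟩) hZ
    (Nat.lt_succ_self _) hN hXm (by omega)
  obtain ⟨r7'', r8'', h3⟩ := Runs.push (X := X) (N := N) (cur := cur) (mode := 1)
    (m := s.length) (dep := dep)
    (a := 0 + (Z.takeWhile p).countP fun y => s.length + 1 - y ≤ dep)
    (y := (Z.dropWhile p).headD 0) (r7 := r7') (r8 := r8') (r9 := r9) (r10 := r10')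
    (r11 := r11) (r12 := r12) (r13 := r13) (rc := s.length + 1)
    (M := popBlocks M s.length (Z.takeWhile p)) hN
  refine ⟨4 + (n2 + 6), _, _, (Z.dropWhile p).headD 0, r7'', r8'', r10', ?_, hinv, ?_, ?_⟩
  rotate_left 2
  · have := h1.trans (h2.trans h3)
    rw [Nat.zero_add, hcount dep] at this
    exact this
  · have := congrArg List.length (List.takeWhile_append_dropWhile (p := p) (l := Z))
    simp only [List.length_append, List.length_cons] at this ⊢
    omega
  · intro g b hgb
    simp only [put, popBlocks_apply]
    rw [if_neg (by omega), if_neg]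
    rintro ⟨hg, hb1, hb⟩
    have := hZ _ ((List.takeWhile_prefix p).subset hb)
    omega

end Stack

/-! ### The representation of the tree -/

theorem LinkedList.congr {mem mem' : ℕ → ℕ} {addr addr' : List ℕ → ℕ} {x : ℕ}
    {vs : List (List ℕ)} (h : LinkedList mem addr x vs)
    (hc : ∀ v ∈ vs, addr' v = addr v ∧ mem' (addr v + 3) = mem (addr v + 3)) :
    LinkedList mem' addr' x vs := by
  induction vs generalizing x with
  | nil => exact h
  | cons v vs ih =>
    obtain ⟨e1, e2⟩ := hc v (by simp)
    refine ⟨h.1.trans e1.symm, ?_⟩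
    rw [e1, e2]
    exact ih h.2 fun w hw => hc w (by simp [hw])

theorem length_suffixLink (u : List ℕ) : (suffixLink u).length = u.length - 1 := by
  simp [suffixLink]

/-- The memory `M` holds the trie `T`, with all suffix links between its nodes. The node `u` has
the block `blk u`, the blocks from `m + 2` on are not used, `tree v` is the search tree of the
nodes with suffix link `v`, and the labels have `L` binary digits. -/
structure TreeInv (m : ℕ) (T : Trie) (M : ℕ → ℕ → ℕ) (blk : List ℕ → ℕ)
    (tree : List ℕ → SearchTree) (L : ℕ) : Prop where
  inj : Set.InjOn blk (T : Set (List ℕ))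
  root : blk [] = 1
  bounds : ∀ u ∈ T, 1 ≤ blk u ∧ blk u ≤ m + 1
  parent : ∀ u ∈ T, M 0 (blk u) = if u = [] then 0 else 16 * blk u.dropLast
  label : ∀ u ∈ T, M 1 (blk u) = u.getLastD 0
  children : ∀ u ∈ T, ∃ vs : List (List ℕ), vs.Nodup ∧
    (∀ v, v ∈ vs ↔ v ∈ T ∧ ∃ a, v = u ++ [a]) ∧
    LinkedList (blocks M) (fun v => 16 * blk v) (M 2 (blk u)) vs
  source : ∀ u ∈ T, u ≠ [] → M 4 (blk u) = 16 * blk (suffixLink u)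
  key : ∀ u ∈ T, u ≠ [] → M 5 (blk u) = (frontPointers u).card
  stored : ∀ v ∈ T, (tree v).Stored M (M 8 (blk v))
  nodup : ∀ v ∈ T, (tree v).support.Nodup
  digital : ∀ v ∈ T, (tree v).Digital (M 5) id L
  mem_support : ∀ v ∈ T, ∀ b, b ∈ (tree v).support ↔
    ∃ u ∈ T, u ≠ [] ∧ suffixLink u = v ∧ blk u = b
  find : ∀ u ∈ T, u ≠ [] → suffixLink u ∈ T →
    (tree (suffixLink u)).find (M 5) (frontPointers u).card (frontPointers u).card = some (blk u)
  unused : ∀ b, m + 2 ≤ b → ∀ f ≤ 8, M f b = 0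

theorem TreeInv.congr {m : ℕ} {T : Trie} {M M' : ℕ → ℕ → ℕ} {blk : List ℕ → ℕ}
    {tree : List ℕ → SearchTree} {L : ℕ} (h : TreeInv m T M blk tree L)
    (hM : ∀ f ≤ 8, M' f = M f) : TreeInv m T M' blk tree L where
  inj := h.inj
  root := h.root
  bounds := h.bounds
  parent := by rw [hM 0 (by omega)]; exact h.parent
  label := by rw [hM 1 (by omega)]; exact h.label
  children u hu := by
    obtain ⟨vs, h1, h2, h3⟩ := h.children u hu
    refine ⟨vs, h1, h2, ?_⟩
    rw [hM 2 (by omega)]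
    refine h3.congr fun v _ => ⟨rfl, ?_⟩
    rw [blocks_add _ _ (by omega), blocks_add _ _ (by omega), hM 3 (by omega)]
  source := by rw [hM 4 (by omega)]; exact h.source
  key := by rw [hM 5 (by omega)]; exact h.key
  stored v hv := by
    rw [hM 8 (by omega)]
    exact (h.stored v hv).congr fun b _ => by rw [hM 6 (by omega), hM 7 (by omega)]; simp
  nodup := h.nodup
  digital := by rw [hM 5 (by omega)]; exact h.digital
  mem_support := h.mem_support
  find := by rw [hM 5 (by omega)]; exact h.find
  unused b hb f hf := by rw [hM f hf]; exact h.unused b hb f hf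

/-- The search for `a` fails if no node with suffix link `v` has `a` front pointers. -/
theorem TreeInv.find_eq_none {m : ℕ} {T : Trie} {M : ℕ → ℕ → ℕ} {blk : List ℕ → ℕ}
    {tree : List ℕ → SearchTree} {L : ℕ} (h : TreeInv m T M blk tree L) {v : List ℕ} (hv : v ∈ T)
    {a : ℕ} (ha : ∀ u ∈ T, u ≠ [] → suffixLink u = v → a ≠ (frontPointers u).card) :
    (tree v).find (M 5) a a = none := by
  rw [Option.eq_none_iff_forall_ne_some]
  intro b hb
  obtain ⟨hb, hk⟩ := SearchTree.mem_support_of_find hb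
  obtain ⟨u, hu, hne, hsl, rfl⟩ := (h.mem_support v hv b).1 hb
  rw [h.key u hu hne] at hk
  exact ha u hu hne hsl hk.symm

section Create

variable {M : ℕ → ℕ → ℕ} {m w label pv pa f b : ℕ}

theorem createBlocks_apply_of_lt (hf : 6 ≤ f) {g : ℕ} (hg : g < 6) (y : ℕ) :
    createBlocks M m w label pv pa f b g y =
      put (put (put (put (put (put M 0 (m + 2) (16 * w)) 1 (m + 2) label) 2 w (16 * (m + 2)))
        3 (m + 2) (M 2 w)) 4 (m + 2) pv) 5 (m + 2) pa g y := by
  rw [createBlocks, put, if_neg (by omega)]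

theorem createBlocks_apply_of_le {g : ℕ} (hg : 6 ≤ g) (y : ℕ) :
    createBlocks M m w label pv pa f b g y = put M f b (16 * (m + 2)) g y := by
  simp only [createBlocks, put]
  simp only [show g ≠ 0 by omega, show g ≠ 1 by omega, show g ≠ 2 by omega, show g ≠ 3 by omega,
    show g ≠ 4 by omega, show g ≠ 5 by omega, false_and, if_false]

end Create

/-- Creation of a node `p ++ [c]` in the memory. The cell that receives its address is the one at
which the search for its label among the reversed suffix links of `suffixLink (p ++ [c])` fails. -/
theorem TreeInv.create {m : ℕ} {T : Trie} {M : ℕ → ℕ → ℕ} {blk : List ℕ → ℕ}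
    {tree : List ℕ → SearchTree} {L : ℕ} (h : TreeInv m T M blk tree L)
    (hdl : ∀ v ∈ T, v.dropLast ∈ T) (hsl : ∀ v ∈ T, v ≠ [] → suffixLink v ∈ T)
    {p : List ℕ} {c : ℕ} {u v' : List ℕ} {a : ℕ} (hu : u = p ++ [c]) (hp : p ∈ T) (huT : u ∉ T)
    (hv' : suffixLink u = v') (hv'T : v' ∈ T) (ha : (frontPointers u).card = a) (haL : a < 2 ^ L)
    (hfind : (tree v').find (M 5) a a = none) {q : ℕ × ℕ}
    (hq : (tree v').place a (8, blk v') = q) :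
    TreeInv (m + 1) (insert u T) (createBlocks M m (blk p) c (16 * blk v') a q.1 q.2)
      (Function.update blk u (m + 2))
      (Function.update (Function.update tree v' ((tree v').insert (m + 2) a)) u .leaf) L := by
  obtain ⟨f, b⟩ := q
  set M' := createBlocks M m (blk p) c (16 * blk v') a f b with hM'
  set blk' := Function.update blk u (m + 2) with hblk'
  have hb : ∀ v ∈ T, blk' v = blk v := fun v hv =>
    Function.update_of_ne (fun e : v = u => huT (e ▸ hv)) _ _
  have hbu : blk' u = m + 2 := Function.update_self _ _ _
  have hne : ∀ v ∈ T, v ≠ u := fun v hv e => huT (e ▸ hv)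
  have hu0 : u ≠ [] := by rw [hu]; simp
  have hle : ∀ v ∈ T, blk v ≠ m + 2 := fun v hv => by have := h.bounds v hv; omega
  have hplace : (f = 8 ∧ b = blk v') ∨ (f = 6 ∨ f = 7) ∧ b ∈ (tree v').support := by
    rcases (tree v').place_eq_or a (8, blk v') with e | ⟨e, e'⟩
    · rw [hq] at e
      exact Or.inl (Prod.mk.injEq .. ▸ e)
    · rw [hq] at e e'
      exact Or.inr ⟨e, e'⟩
  have hf6 : 6 ≤ f := by omega
  have hf8 : f ≤ 8 := by omega
  have hbm : b ≤ m + 1 := by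
    rcases hplace with ⟨-, rfl⟩ | ⟨-, e⟩
    · exact (h.bounds v' hv'T).2
    · obtain ⟨x, hx, -, -, rfl⟩ := (h.mem_support v' hv'T b).1 e
      exact (h.bounds x hx).2
  have hsup : ∀ v ∈ T, ∀ x ∈ (tree v).support, x ≤ m + 1 := by
    intro v hv x hx
    obtain ⟨y, hy, -, -, rfl⟩ := (h.mem_support v hv x).1 hx
    exact (h.bounds y hy).2
  -- the new node is not the source of any link, so its search tree is empty
  have hslu : ∀ v, suffixLink v = u → v ∉ insert u T := by
    intro v hv hvT
    rcases Finset.mem_insert.1 hvT with rfl | hvT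
    · have h1 := congrArg List.length hv
      rw [length_suffixLink] at h1
      have := List.length_pos_iff.2 hu0
      omega
    · rcases eq_or_ne v [] with rfl | hv0
      · exact hu0 (hv.symm.trans rfl)
      · exact huT (hv ▸ hsl v hvT hv0)
  have hp2 : blk p ≠ m + 2 := hle p hp
  have e0 : ∀ y, M' 0 y = if y = m + 2 then 16 * blk p else M 0 y := by
    intro y; rw [hM', createBlocks_apply_of_lt hf6 (by omega)]; simp [put]
  have e1 : ∀ y, M' 1 y = if y = m + 2 then c else M 1 y := by
    intro y; rw [hM', createBlocks_apply_of_lt hf6 (by omega)]; simp [put]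
  have e2 : ∀ y, M' 2 y = if y = blk p then 16 * (m + 2) else M 2 y := by
    intro y; rw [hM', createBlocks_apply_of_lt hf6 (by omega)]; simp [put]
  have e3 : ∀ y, M' 3 y = if y = m + 2 then M 2 (blk p) else M 3 y := by
    intro y; rw [hM', createBlocks_apply_of_lt hf6 (by omega)]; simp [put]
  have e4 : ∀ y, M' 4 y = if y = m + 2 then 16 * blk v' else M 4 y := by
    intro y; rw [hM', createBlocks_apply_of_lt hf6 (by omega)]; simp [put]
  have e5 : ∀ y, M' 5 y = if y = m + 2 then a else M 5 y := by
    intro y; rw [hM', createBlocks_apply_of_lt hf6 (by omega)]; simp [put]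
  have e6 : ∀ g, 6 ≤ g → ∀ y, M' g y = put M f b (16 * (m + 2)) g y :=
    fun g hg y => createBlocks_apply_of_le hg y
  have hkey : ∀ v ∈ T, ∀ x ∈ (tree v).support, M' 5 x = M 5 x := by
    intro v hv x hx
    have := hsup v hv x hx
    rw [e5, if_neg (by omega)]
  -- the changed cell belongs to the search tree of `v'` only
  have hother : ∀ v ∈ T, v ≠ v' → M' 8 (blk v) = M 8 (blk v) ∧
      ∀ x ∈ (tree v).support, M' 6 x = M 6 x ∧ M' 7 x = M 7 x := by
    intro v hv hvv
    refine ⟨?_, fun x hx => ?_⟩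
    · rw [e6 8 (by omega), put, if_neg]
      rintro ⟨e, e'⟩
      rcases hplace with ⟨-, e''⟩ | ⟨e'', -⟩
      · exact hvv (h.inj hv hv'T (e'.trans e''))
      · omega
    · have hxb : ¬ ((f = 6 ∨ f = 7) ∧ x = b) := by
        rintro ⟨e, rfl⟩
        rcases hplace with ⟨e', -⟩ | ⟨-, e'⟩
        · omega
        · obtain ⟨y, hy, -, hy2, hy3⟩ := (h.mem_support v hv x).1 hx
          obtain ⟨z, hz, -, hz2, hz3⟩ := (h.mem_support v' hv'T x).1 e'
          obtain rfl : y = z := h.inj hy hz (hy3.trans hz3.symm)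
          exact hvv (hy2.symm.trans hz2)
      rw [e6 6 (by omega), e6 7 (by omega), put, put, if_neg, if_neg]
      · exact ⟨rfl, rfl⟩
      · exact fun e => hxb ⟨Or.inr e.1.symm, e.2⟩
      · exact fun e => hxb ⟨Or.inl e.1.symm, e.2⟩
  set tree' := Function.update (Function.update tree v' ((tree v').insert (m + 2) a)) u .leaf
    with htree'
  have htu : tree' u = .leaf := Function.update_self _ _ _
  have htv' : tree' v' = (tree v').insert (m + 2) a := by
    rw [htree', Function.update_of_ne (hne v' hv'T), Function.update_self]
  have hto : ∀ v ∈ T, v ≠ v' → tree' v = tree v := by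
    intro v hv hvv
    rw [htree', Function.update_of_ne (hne v hv), Function.update_of_ne hvv]
  have hm2 : m + 2 ∉ (tree v').support := fun hx => by
    have := hsup v' hv'T _ hx
    omega
  refine ⟨?_, ?_, ?_, ?_, ?_, ?_, ?_, ?_, ?_, ?_, ?_, ?_, ?_, ?_⟩
  · intro x hx y hy hxy
    simp only [Finset.coe_insert, Set.mem_insert_iff, Finset.mem_coe] at hx hy
    rcases hx with rfl | hx <;> rcases hy with rfl | hy
    · rfl
    · rw [hbu, hb y hy] at hxy
      exact absurd hxy.symm (hle y hy)
    · rw [hbu, hb x hx] at hxy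
      exact absurd hxy (hle x hx)
    · rw [hb x hx, hb y hy] at hxy
      exact h.inj hx hy hxy
  · rw [hblk', Function.update_of_ne hu0.symm, h.root]
  · intro v hv
    rcases Finset.mem_insert.1 hv with rfl | hv
    · omega
    · have := h.bounds v hv
      rw [hb v hv]
      omega
  · intro v hv
    rcases Finset.mem_insert.1 hv with rfl | hv
    · rw [hbu, e0, if_pos rfl, if_neg hu0, hu, List.dropLast_concat, hb p hp]
    · rw [hb v hv, hb _ (hdl v hv), e0, if_neg (hle v hv), h.parent v hv]
  · intro v hv
    rcases Finset.mem_insert.1 hv with rfl | hv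
    · rw [hbu, e1, if_pos rfl, hu]
      simp
    · rw [hb v hv, e1, if_neg (hle v hv), h.label v hv]
  · intro v hv
    have hcong : ∀ x vs, (∀ y ∈ vs, y ∈ T) →
        LinkedList (blocks M) (fun v => 16 * blk v) x vs →
        LinkedList (blocks M') (fun v => 16 * blk' v) x vs := by
      intro x vs hvs hx
      refine hx.congr fun y hy => ⟨by rw [hb y (hvs y hy)], ?_⟩
      rw [blocks_add _ _ (by omega), blocks_add _ _ (by omega), e3,
        if_neg (hle y (hvs y hy))]
    rcases Finset.mem_insert.1 hv with rfl | hv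
    · refine ⟨[], List.nodup_nil, fun y => ?_, ?_⟩
      · simp only [List.not_mem_nil, false_iff, not_and, not_exists]
        rintro hy x rfl
        rcases Finset.mem_insert.1 hy with hy | hy
        · simp at hy
        · have := hdl _ hy
          rw [List.dropLast_concat] at this
          exact huT this
      · rw [hbu, e2, if_neg hp2.symm]
        exact h.unused _ le_rfl 2 (by omega)
    · obtain ⟨vs, h1, h2, h3⟩ := h.children v hv
      have hvs : ∀ y ∈ vs, y ∈ T := fun y hy => ((h2 y).1 hy).1
      by_cases hvp : v = p
      · subst hvp
        refine ⟨u :: vs, ?_, fun y => ?_, ?_⟩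
        · exact List.nodup_cons.2 ⟨fun hy => huT (hvs u hy), h1⟩
        · rw [List.mem_cons, h2, Finset.mem_insert]
          constructor
          · rintro (rfl | ⟨hy, hy'⟩)
            · exact ⟨Or.inl rfl, c, hu⟩
            · exact ⟨Or.inr hy, hy'⟩
          · rintro ⟨rfl | hy, hy'⟩
            · exact Or.inl rfl
            · exact Or.inr ⟨hy, hy'⟩
        · refine ⟨?_, ?_⟩
          · rw [hb v hv, e2, if_pos rfl]
            exact congrArg (16 * ·) hbu.symm
          · simp only [hbu]
            rw [blocks_add _ _ (by omega), e3, if_pos rfl]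
            exact hcong _ _ hvs h3
      · refine ⟨vs, h1, fun y => ?_, ?_⟩
        · rw [h2, Finset.mem_insert]
          constructor
          · rintro ⟨hy, hy'⟩
            exact ⟨Or.inr hy, hy'⟩
          · rintro ⟨rfl | hy, x, hx⟩
            · have := congrArg List.dropLast (hu.symm.trans hx)
              rw [List.dropLast_concat, List.dropLast_concat] at this
              exact absurd this.symm hvp
            · exact ⟨hy, x, hx⟩
        · rw [hb v hv, e2, if_neg fun e => hvp (h.inj hv hp e)]
          exact hcong _ _ hvs h3
  · intro v hv hv0
    rcases Finset.mem_insert.1 hv with rfl | hv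
    · rw [hbu, e4, if_pos rfl, hv', hb v' hv'T]
    · rw [hb v hv, e4, if_neg (hle v hv), h.source v hv hv0, hb _ (hsl v hv hv0)]
  · intro v hv hv0
    rcases Finset.mem_insert.1 hv with rfl | hv
    · rw [hbu, e5, if_pos rfl, ha]
    · rw [hb v hv, e5, if_neg (hle v hv), h.key v hv hv0]
  · intro v hv
    rcases Finset.mem_insert.1 hv with rfl | hv
    · rw [htu, hbu, e6 8 (by omega), put, if_neg (by omega)]
      exact h.unused _ le_rfl 8 le_rfl
    · rw [hb v hv]
      by_cases hvv : v = v'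
      · subst hvv
        rw [htv']
        have hst := (h.stored v hv).insert (k := a) (h.nodup v hv) (by simp) (c := m + 2)
          (by omega) hm2 (h.unused _ le_rfl 6 (by omega)) (h.unused _ le_rfl 7 (by omega))
          (by simp)
        simp only [hq] at hst
        rw [e6 8 (by omega)]
        exact hst.congr fun x _ => ⟨e6 6 (by omega) x, e6 7 (by omega) x⟩
      · rw [hto v hv hvv, (hother v hv hvv).1]
        exact (h.stored v hv).congr (hother v hv hvv).2
  · intro v hv
    rcases Finset.mem_insert.1 hv with rfl | hv
    · rw [htu]
      exact List.nodup_nil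
    · by_cases hvv : v = v'
      · subst hvv
        rw [htv']
        exact SearchTree.nodup_insert (h.nodup v hv) hm2
      · rw [hto v hv hvv]
        exact h.nodup v hv
  · intro v hv
    rcases Finset.mem_insert.1 hv with rfl | hv
    · rw [htu]
      trivial
    · by_cases hvv : v = v'
      · subst hvv
        rw [htv']
        refine ((h.digital v hv).congr (hkey v hv)).insert ?_ rfl haL ?_
        · rw [e5, if_pos rfl]
          rfl
        · rw [SearchTree.find_congr (hkey v hv)]
          exact hfind
      · rw [hto v hv hvv]
        exact (h.digital v hv).congr (hkey v hv)
  · intro v hv x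
    rcases Finset.mem_insert.1 hv with rfl | hv
    · rw [htu]
      simp only [SearchTree.support, List.not_mem_nil, false_iff]
      rintro ⟨y, hy, -, hy', -⟩
      exact hslu y hy' hy
    · by_cases hvv : v = v'
      · subst hvv
        rw [htv', SearchTree.mem_support_insert, h.mem_support v hv]
        constructor
        · rintro (rfl | ⟨y, hy, hy0, hy1, rfl⟩)
          · exact ⟨u, Finset.mem_insert_self _ _, hu0, hv', hbu⟩
          · exact ⟨y, Finset.mem_insert_of_mem hy, hy0, hy1, hb y hy⟩
        · rintro ⟨y, hy, hy0, hy1, rfl⟩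
          rcases Finset.mem_insert.1 hy with rfl | hy
          · exact Or.inl hbu
          · exact Or.inr ⟨y, hy, hy0, hy1, (hb y hy).symm⟩
      · rw [hto v hv hvv, h.mem_support v hv]
        constructor
        · rintro ⟨y, hy, hy0, hy1, rfl⟩
          exact ⟨y, Finset.mem_insert_of_mem hy, hy0, hy1, hb y hy⟩
        · rintro ⟨y, hy, hy0, hy1, rfl⟩
          rcases Finset.mem_insert.1 hy with rfl | hy
          · exact absurd (hy1.symm.trans hv') hvv
          · exact ⟨y, hy, hy0, hy1, (hb y hy).symm⟩
  · have hfi : ∀ a' , ((tree v').insert (m + 2) a).find (M' 5) a' a' =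
        if a' = a then some (m + 2) else (tree v').find (M 5) a' a' := by
      intro a'
      rw [SearchTree.find_insert (by rw [e5, if_pos rfl]) ?_ a' a' id,
        SearchTree.find_congr (hkey v' hv'T)]
      rw [SearchTree.find_congr (hkey v' hv'T)]
      exact hfind
    intro v hv hv0 hv1
    rcases Finset.mem_insert.1 hv with rfl | hv
    · rw [hv', htv', hfi, ha, if_pos rfl, hbu]
    · have hs := hsl v hv hv0
      rw [hb v hv]
      by_cases hvv : suffixLink v = v'
      · have hf := h.find v hv hv0 hs
        rw [hvv] at hf ⊢
        rw [htv', hfi, if_neg, hf]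
        intro e
        rw [e, hfind] at hf
        exact absurd hf (by simp)
      · rw [hto _ hs hvv, SearchTree.find_congr (hkey _ hs)]
        exact h.find v hv hv0 hs
  · intro y hy g hg
    by_cases hg6 : g < 6
    · rw [hM', createBlocks_apply_of_lt hf6 hg6]
      have := h.bounds p hp
      simp only [put]
      simp only [show y ≠ m + 2 by omega, show y ≠ blk p by omega, and_false, if_false]
      exact h.unused y (by omega) g hg
    · rw [e6 g (by omega), put, if_neg (by omega)]
      exact h.unused y (by omega) g hg

/-! ### The iterations of the algorithm on the machine -/

section Iteration

variable {α : Type*} [LinearOrder α] {N : ℕ} {X : List α}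

theorem IsCorrect.dropLast_mem {s : List α} {A : AlgState} {k : ℕ} (h : IsCorrect s A k) :
    ∀ v ∈ A.nodes, v.dropLast ∈ A.nodes := by
  intro v hv
  rw [h.nodes] at hv ⊢
  rw [List.dropLast_eq_take]
  exact take_mem_cph hv _

theorem IsCorrect.suffixLink_mem {s : List α} {A : AlgState} {k : ℕ} (h : IsCorrect s A k) :
    ∀ v ∈ A.nodes, v ≠ [] → suffixLink v ∈ A.nodes := by
  intro v hv hv0
  rw [h.nodes] at hv ⊢
  exact cph_tail_subset s (suffixLink_mem_cph_tail s v hv hv0)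

theorem IsCorrect.anc_mem {s : List α} {A : AlgState} {k : ℕ} (h : IsCorrect s A k) (e : ℕ) :
    anc A.last e ∈ A.nodes := by
  rw [h.anc_last, h.nodes]
  exact h.depth.take_mem (Nat.sub_le _ _)

/-- A configuration of the machine holds the snapshot whose data satisfy the invariants. -/
theorem TreeInv.holds {s : List α} {A : AlgState} {k : ℕ} (hA : IsCorrect s A k) {m : ℕ}
    {M : ℕ → ℕ → ℕ} {blk : List ℕ → ℕ} {tree : List ℕ → SearchTree} {L : ℕ}
    (h : TreeInv m A.nodes M blk tree L) (hN : 16 * (m + 1) + 15 < N) {v : List ℕ}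
    (hv : v ∈ A.nodes) {pc rc : ℕ} {R : List ℕ} (h0 : R.getD 0 0 = 16)
    (h1 : R.getD 1 0 = 16 * blk v) :
    Holds N ⟨pc, regs R, blocks M, rc⟩ ⟨A, v, rc⟩ := by
  refine ⟨rfl, fun u => 16 * blk u, ?_, hv, ?_, h1, ?_⟩
  · intro x hx y hy hxy
    exact h.inj hx hy (Nat.eq_of_mul_eq_mul_left (by omega) hxy)
  · simp only [h.root]
    exact h0
  · intro u hu
    have hb := h.bounds u hu
    refine ⟨show 0 < 16 * blk u by omega, show 16 * blk u + 5 < N by omega, ?_, ?_, ?_, ?_⟩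
    · exact (blocks_add M (f := 0) (blk u) (by omega)).trans (h.parent u hu)
    · exact (blocks_add M (f := 1) (blk u) (by omega)).trans (h.label u hu)
    · simp only [blocks_add M (f := 2) (blk u) (by omega)]
      exact h.children u hu
    · intro hu0 w hw a
      simp only [blocks_add M (f := 4) (blk u) (by omega), blocks_add M (f := 5) (blk u) (by omega),
        h.source u hu hu0, h.key u hu hu0, hA.rsl, IsRsl]
      constructor
      · rintro ⟨-, -, -, rfl, rfl⟩
        exact ⟨rfl, rfl⟩
      · rintro ⟨e1, rfl⟩
        exact ⟨hw, hu, hu0, h.inj (hA.suffixLink_mem u hu hu0) hw (by omega), rfl⟩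

theorem card_frontPointers_le (u : List ℕ) : (frontPointers u).card ≤ u.length :=
  (Finset.card_filter_le _ _).trans (by simp)

variable {s : List α} {A : AlgState} {k : ℕ} {M : ℕ → ℕ → ℕ} {Z : List ℕ}
  {blk : List ℕ → ℕ} {tree : List ℕ → SearchTree} {L : ℕ}

theorem TreeInv.support_lt (h : TreeInv s.length A.nodes M blk tree L) (hA : IsCorrect s A k)
    (hN : 16 * (s.length + 2) + 15 < N) {v : List ℕ} (hv : v ∈ A.nodes) :
    ∀ w ∈ (tree v).support, 16 * w + 15 < N ∧ M 5 w < N := by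
  intro w hw
  obtain ⟨u, hu, hu0, -, rfl⟩ := (h.mem_support v hv w).1 hw
  have h1 := h.bounds u hu
  have h2 := card_frontPointers_le u
  rw [hA.nodes] at hu
  have h3 := length_le_of_mem_cph hu
  rw [h.key u (hA.nodes ▸ hu) hu0]
  omega

/-- The reversed suffix links are found in the search trees. -/
theorem TreeInv.find_of_rsl (h : TreeInv s.length A.nodes M blk tree L) (hA : IsCorrect s A k)
    {v p : List ℕ} {a : ℕ} (hr : A.rsl v a = some p) :
    (tree v).find (M 5) a a = some (blk p) := by
  obtain ⟨h1, h2, h3, rfl, rfl⟩ := (hA.rsl v a p).1 hr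
  exact h.find p h2 h3 h1

theorem TreeInv.find_of_rsl_none (h : TreeInv s.length A.nodes M blk tree L)
    (hA : IsCorrect s A k) {v : List ℕ} {a : ℕ} (hv : v ∈ A.nodes) (hr : A.rsl v a = none) :
    (tree v).find (M 5) a a = none := by
  refine h.find_eq_none hv fun u hu hu0 hsl ha => ?_
  have := (hA.rsl v a u).2 ⟨hv, hu, hu0, hsl, ha⟩
  rw [hr] at this
  exact absurd this (by simp)

/-- The configuration in which the machine starts to search for a link from the `e`-th ancestor of
the last node `u`. -/
def searchConfig (S : List α) (u : List ℕ) (blk : List ℕ → ℕ) (M : ℕ → ℕ → ℕ) (e : ℕ)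
    (r6 r7 r8 r9 r10 r11 r12 r13 : ℕ) : Config :=
  ⟨16, regs (file (16 * blk (anc u e)) 1 (S.length - 1) (u.length - e) (rslLabel S (anc u e))
    r6 r7 r8 r9 r10 r11 r12 r13), blocks M, S.length⟩

/-- Registers `11`, `12`, `13` describe the missing reversed suffix link from the `e`-th ancestor
of `u`. -/
def Missing (S : List α) (u : List ℕ) (blk : List ℕ → ℕ) (tree : List ℕ → SearchTree) (e : ℕ)
    (r11 r12 r13 : ℕ) : Prop :=
  let v := anc u e
  let a := rslLabel S v
  let q := (tree v).place a (8, blk v)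
  r11 = 16 * q.2 + q.1 ∧ r12 = 16 * blk v ∧ r13 = a

/-- The data for a new character `x`: the tree still belongs to `s`, and the parent distances
belong to `x :: s` already. -/
structure ClimbInv (x : α) (s : List α) (A : AlgState) (k : ℕ) (M : ℕ → ℕ → ℕ) (Z : List ℕ)
    (blk : List ℕ → ℕ) (tree : List ℕ → SearchTree) (L N : ℕ) : Prop where
  correct : IsCorrect s A k
  tree : TreeInv s.length A.nodes M blk tree L
  string : StringInv (x :: s) M Z
  memory : 16 * (s.length + 2) + 15 < N
  labels : ∀ w : List α, (frontPointers (pd w)).card < 2 ^ L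

theorem ClimbInv.label_bounds {x : α} (h : ClimbInv x s A k M Z blk tree L N) (e : ℕ) :
    rslLabel (x :: s) (anc A.last e) < 2 ^ L ∧ rslLabel (x :: s) (anc A.last e) < N := by
  refine ⟨h.labels _, ?_⟩
  have h1 := card_frontPointers_le (pd ((x :: s).take ((anc A.last e).length + 1)))
  have h2 := h.memory
  have h3 : (pd ((x :: s).take ((anc A.last e).length + 1))).length ≤ s.length + 1 := by simp
  rw [rslLabel]
  omega

/-- One step of the climb: the link from the `e`-th ancestor is missing. -/
theorem ClimbInv.climb {x : α} (h : ClimbInv x s A k M Z blk tree L N) {e : ℕ} (he : e < k)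
    (hr : A.rsl (anc A.last e) (rslLabel (x :: s) (anc A.last e)) = none)
    (r6 r7 r8 r9 r10 r11 r12 r13 : ℕ) :
    ∃ n c r6' r7' r8' r9' r10' r11' r12' r13', n ≤ 14 * L + 24 ∧
      Runs N X n [c] (searchConfig (x :: s) A.last blk M e r6 r7 r8 r9 r10 r11 r12 r13)
        (searchConfig (x :: s) A.last blk M (e + 1) r6' r7' r8' r9' r10' r11' r12' r13') ∧
      Missing (x :: s) A.last blk tree e r11' r12' r13' ∧
      Holds N c ⟨A, anc A.last (e + 1), (x :: s).length⟩ := by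
  have hA := h.correct
  have hT := h.tree
  have hv := hA.anc_mem e
  have hv' := hA.anc_mem (e + 1)
  have hb := hT.bounds _ hv
  have hb' := hT.bounds _ hv'
  have hN := h.memory
  have hks := hA.depth.le_length
  have hlast := hA.length_last
  obtain ⟨hL, haN⟩ := h.label_bounds e
  set a := rslLabel (x :: s) (anc A.last e) with ha
  have h1 := Runs.search_start (N := N) (X := X) (M := M) (mode := 1) (m := s.length)
    (dep := A.last.length - e) (r6 := r6) (r7 := r7) (r8 := r8) (r9 := r9) (r10 := r10)
    (r11 := r11) (r12 := r12) (r13 := r13) (rc := s.length + 1) (v := blk (anc A.last e))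
    (by omega) haN
  obtain ⟨n2, s7, s8, s10, hn2, h2⟩ := Runs.search_none (N := N) (X := X)
    (cur := 16 * blk (anc A.last e)) (mode := 1) (m := s.length) (dep := A.last.length - e)
    (a := a) (r6 := r6) (r7 := 8) (r8 := r8) (r11 := r11) (r12 := r12) (r13 := r13)
    (rc := s.length + 1) (hT.stored _ hv) (hT.digital _ hv) (hT.support_lt hA hN hv)
    (k := a) rfl hL haN (by omega) (by omega) (hT.find_of_rsl_none hA hv hr)
  set q := (tree (anc A.last e)).place a (8, blk (anc A.last e)) with hq
  have hqN : 16 * q.2 + q.1 < N := by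
    rcases (tree (anc A.last e)).place_eq_or a (8, blk (anc A.last e)) with h' | ⟨h', h''⟩
    · rw [← hq] at h'
      simp only [h']
      omega
    · rw [← hq] at h' h''
      have := (hT.support_lt hA hN hv _ h'').1
      omega
  -- the entry of the encoding at the position that the climb leaves
  obtain ⟨w, hw⟩ : ∃ w, (pd (x :: s))[k - e]? = some w :=
    ⟨_, List.getElem?_eq_getElem (by simp; omega)⟩
  have hw1 : M 10 (s.length - (A.last.length - e) + 2) = w := by
    have := h.string.dist (s.length + 1 - (k - e)) (by omega) (by simp)
    rw [List.length_cons, show s.length + 1 - (s.length + 1 - (k - e)) = k - e by omega, hw,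
      show s.length + 1 - (k - e) + 1 = s.length - (A.last.length - e) + 2 by omega] at this
    exact (Option.some_inj.1 this).symm
  have hw2 : w ≤ A.last.length - e := by
    rw [hlast]
    obtain ⟨h', rfl⟩ := List.getElem?_eq_some_iff.1 hw
    exact pd_getElem_le _ _ _
  have hpar : M 0 (blk (anc A.last e)) = 16 * blk (anc A.last (e + 1)) := by
    rw [hT.parent _ hv, if_neg, hA.anc_last, hA.anc_last, List.dropLast_eq_take, List.take_take,
      List.length_take, length_pd, show min (min (k - e) s.length - 1) (k - e) = k - (e + 1) by omega]
    · intro h0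
      have := congrArg List.length h0
      rw [hA.anc_last, List.length_take, length_pd, List.length_nil] at this
      omega
  obtain ⟨n3, t8, hn3, h3⟩ := Runs.climb (N := N) (X := X) (M := M) (v := blk (anc A.last e))
    (q := w) (mode := 1) (m := s.length) (dep := A.last.length - e) (a := a) (r6 := 0) (r7 := s7)
    (r8 := s8) (r9 := 16 * q.2 + q.1) (r10 := s10) (r11 := r11) (r12 := r12) (r13 := r13)
    (rc := s.length + 1) (by omega) haN hqN hN hw1 (by omega) (by omega) hpar (by omega) rfl
  have hlab : a - (if w = A.last.length - e then 1 else 0) =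
      rslLabel (x :: s) (anc A.last (e + 1)) := by
    rw [ha, hA.anc_last, hA.anc_last, rslLabel_take x s (by omega), rslLabel_take x s (by omega),
      show k - (e + 1) + 1 = k - e by omega, card_frontPointers_take_succ, hlast]
    have : k - e ∈ frontPointers (pd (x :: s)) ↔ w = k - e := by
      rw [mem_frontPointers, hw, Option.some_inj]
      exact ⟨fun h => h.2, fun h => ⟨by omega, h⟩⟩
    simp only [this]
    split_ifs <;> simp
  have h4 := Runs.observe_neg (N := N) (X := X) (M := M) (rc := s.length + 1)
    (R := file (16 * blk (anc A.last (e + 1))) 1 s.length (A.last.length - e - 1)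
      (a - (if w = A.last.length - e then 1 else 0)) 0 w t8 (16 * q.2 + q.1) s10
      (16 * q.2 + q.1) (16 * blk (anc A.last e)) a) (show ¬ 1 = 0 by omega) (.refl _)
  have h5 := h1.trans (h2.trans (h3.trans h4))
  rw [hlab, Nat.sub_sub] at h5
  refine ⟨_, _, 0, w, t8, 16 * q.2 + q.1, s10, 16 * q.2 + q.1, 16 * blk (anc A.last e), a, ?_, h5,
    ⟨rfl, rfl, rfl⟩, hT.holds hA (by omega) hv' rfl rfl⟩
  omega

/-- The climb up to the `e`-th ancestor. -/
theorem ClimbInv.climbs {x : α} (h : ClimbInv x s A k M Z blk tree L N) {e : ℕ} (he : e ≤ k)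
    (hr : ∀ e' < e, A.rsl (anc A.last e') (rslLabel (x :: s) (anc A.last e')) = none)
    (r6 r7 r8 r9 r10 r11 r12 r13 : ℕ) :
    ∃ n tr r6' r7' r8' r9' r10' r11' r12' r13', n ≤ e * (14 * L + 24) ∧
      Runs N X n tr (searchConfig (x :: s) A.last blk M 0 r6 r7 r8 r9 r10 r11 r12 r13)
        (searchConfig (x :: s) A.last blk M e r6' r7' r8' r9' r10' r11' r12' r13') ∧
      (1 ≤ e → Missing (x :: s) A.last blk tree (e - 1) r11' r12' r13') ∧
      List.Forall₂ (Holds N) tr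
        ((List.range' 1 e).map fun e' => ⟨A, anc A.last e', (x :: s).length⟩) := by
  induction e with
  | zero => exact ⟨0, [], r6, r7, r8, r9, r10, r11, r12, r13, by simp, .refl _, by simp, by simp⟩
  | succ e ih =>
    obtain ⟨n, tr, s6, s7, s8, s9, s10, s11, s12, s13, hn, h1, -, h2⟩ :=
      ih (by omega) fun e' he' => hr e' (by omega)
    obtain ⟨n', c, t6, t7, t8, t9, t10, t11, t12, t13, hn', h1', hm, hc⟩ :=
      h.climb (X := X) (e := e) (by omega) (hr e (by omega)) s6 s7 s8 s9 s10 s11 s12 s13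
    refine ⟨n + n', tr ++ [c], t6, t7, t8, t9, t10, t11, t12, t13, ?_, h1.append h1',
      fun _ => hm, ?_⟩
    · rw [Nat.succ_mul]
      omega
    · rw [List.range'_1_concat, List.map_append]
      refine List.rel_append h2 ?_
      simpa [Nat.add_comm 1 e] using hc

/-- The invariant between the iterations. -/
structure MachineInv (s : List α) (A : AlgState) (k : ℕ) (M : ℕ → ℕ → ℕ) (Z : List ℕ)
    (blk : List ℕ → ℕ) (tree : List ℕ → SearchTree) (L : ℕ) : Prop where
  correct : IsCorrect s A k
  tree : TreeInv s.length A.nodes M blk tree L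
  string : StringInv s M Z
  unused : ∀ b, s.length + 2 ≤ b → M 10 b = 0

/-- `c` is the configuration of the machine after the iteration for the string `s`. The number `w`
is the potential in the analysis of the running time: it pays for the removal of the characters on
the stack and for the climb to the root. -/
def Ready (s : List α) (A : AlgState) (L w : ℕ) (c : Config) : Prop :=
  ∃ k M Z blk tree r5 r6 r7 r8 r9 r10 r11 r12 r13, MachineInv s A k M Z blk tree L ∧
    w = 15 * Z.length + k * (14 * L + 24) ∧
    c = ⟨15, regs (file (16 * blk A.last) 0 s.length k r5 r6 r7 r8 r9 r10 r11 r12 r13),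
      blocks M, s.length⟩

theorem Ready.holds {L w : ℕ} {c : Config} (h : Ready s A L w c)
    (hN : 16 * (s.length + 1) + 15 < N) : Holds N c ⟨A, A.last, s.length⟩ := by
  obtain ⟨k, M, Z, blk, tree, _, _, _, _, _, _, _, _, _, hI, -, rfl⟩ := h
  have := hI.correct.anc_mem 0
  rw [anc, Nat.sub_zero, List.take_length] at this
  exact hI.tree.holds hI.correct hN this rfl rfl

/-- One iteration of the algorithm on the machine. -/
theorem Ready.step {L w : ℕ} {c : Config} (h : Ready s A L w c)
    (hL : ∀ w : List α, (frontPointers (pd w)).card < 2 ^ L) (x : α)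
    (hX : ∀ k ≤ s.length, X[k]? = (x :: s).reverse[k]?)
    (hN : 16 * (s.length + 2) + 15 < N) :
    ∃ n tr c' w' B, iteration A (x :: s) = some B ∧ Ready (x :: s) B L w' c' ∧
      n + w' ≤ w + 3 * (14 * L + 24) + 41 ∧ Runs N X n (c :: tr) c c' ∧
      List.Forall₂ (Holds N) tr (climbSnapshots A (x :: s)) := by
  obtain ⟨k, M, Z, blk, tree, r5, r6, r7, r8, r9, r10, r11, r12, r13, hI, rfl, rfl⟩ := h
  have hA := hI.correct
  have hlast := hA.length_last
  have hks := hA.depth.le_length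
  obtain ⟨d, hd1, hdk, hcd, hnone, hsome, B, hB, hBn, hBc⟩ := hA.step x
  have h1 := Runs.observe_pos (N := N) (X := X) (M := M) (rc := s.length)
    (R := file (16 * blk A.last) 0 s.length k r5 r6 r7 r8 r9 r10 r11 r12 r13) rfl (.refl _)
  obtain ⟨n2, M2, Z2, s6, s7, s8, s10, hn2, hS, hM2, h2⟩ := Runs.receive_and_pop (N := N) (X := X)
    (cur := 16 * blk A.last) (mode := 0) (dep := k) (a := r5) (r6 := r6) (r7 := r7) (r8 := r8)
    (r9 := r9) (r10 := r10) (r11 := r11) (r12 := r12) (r13 := r13) hI.string x hX hN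
    (hI.unused _ le_rfl)
  have hT2 : TreeInv s.length A.nodes M2 blk tree L := hI.tree.congr fun f hf => by
    funext b
    exact hM2 f b (Or.inl ⟨by omega, by omega⟩)
  have hC : ClimbInv x s A k M2 Z2 blk tree L N := ⟨hA, hT2, hS, hN, hL⟩
  obtain ⟨n3, tr, t6, t7, t8, t9, t10, t11, t12, t13, hn3, h3, hmiss, htr⟩ :=
    hC.climbs (X := X) hdk hnone s6 s7 s8 r9 s10 r11 r12 r13
  obtain ⟨rfl, rfl, rfl⟩ := hmiss hd1
  have hstart : (⟨16, regs (file (16 * blk A.last) 1 s.length k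
      (frontPointers ((pd (x :: s)).take (k + 1))).card s6 s7 s8 r9 s10 r11 r12 r13), blocks M2,
        s.length + 1⟩ : Config) =
      searchConfig (x :: s) A.last blk M2 0 s6 s7 s8 r9 s10 r11 r12 r13 := by
    have e : anc A.last 0 = A.last := by rw [anc, Nat.sub_zero, List.take_length]
    have e2 : rslLabel (x :: s) A.last = (frontPointers ((pd (x :: s)).take (k + 1))).card := by
      rw [hA.last, rslLabel_take x s hks]
    rw [searchConfig, e, e2, hlast]
    rfl
  rw [hstart] at h2
  set v := anc A.last d with hv
  set v' := anc A.last (d - 1) with hv'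
  set p := (pd (x :: s)).take (k - d + 1) with hp
  set a' := rslLabel (x :: s) v' with ha'
  set q := (tree v').place a' (8, blk v') with hq
  have hvT : v ∈ A.nodes := hA.anc_mem d
  have hv'T : v' ∈ A.nodes := hA.anc_mem (d - 1)
  have hpT : p ∈ A.nodes := ((hA.rsl _ _ _).1 hsome).2.1
  have hbv := hT2.bounds v hvT
  have hbv' := hT2.bounds v' hv'T
  have hbp := hT2.bounds p hpT
  obtain ⟨hlL, hlN⟩ := hC.label_bounds d
  obtain ⟨hlL', -⟩ := hC.label_bounds (d - 1)
  have h4 := Runs.search_start (N := N) (X := X) (M := M2) (mode := 1) (m := s.length)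
    (dep := A.last.length - d) (r6 := t6) (r7 := t7) (r8 := t8) (r9 := t9) (r10 := t10)
    (r11 := 16 * q.2 + q.1) (r12 := 16 * blk v') (r13 := a') (rc := s.length + 1) (v := blk v)
    (by omega) hlN
  obtain ⟨n5, u7, u8, u9, u10, hn5, h5⟩ := Runs.search_some (N := N) (X := X)
    (cur := 16 * blk v) (mode := 1) (m := s.length) (dep := A.last.length - d)
    (a := rslLabel (x :: s) v) (r6 := t6) (r7 := 8) (r8 := t8) (r11 := 16 * q.2 + q.1)
    (r12 := 16 * blk v') (r13 := a')
    (rc := s.length + 1) (hT2.stored _ hvT) (hT2.digital _ hvT) (hT2.support_lt hA hN hvT)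
    (k := rslLabel (x :: s) v) rfl hlL hlN hlN (by omega) (by omega) (hT2.find_of_rsl hA hsome)
  have hqb : q.1 < 16 ∧ 16 * q.2 + q.1 < N := by
    rcases (tree v').place_eq_or a' (8, blk v') with h' | ⟨h', h''⟩
    · rw [← hq] at h'
      simp only [h']
      omega
    · rw [← hq] at h' h''
      have := (hT2.support_lt hA hN hv'T _ h'').1
      omega
  -- the label of the new edge
  obtain ⟨y, hy⟩ : ∃ y, (pd (x :: s))[k - d + 1]? = some y :=
    ⟨_, List.getElem?_eq_getElem (by simp; omega)⟩
  have hy1 : M2 10 (s.length - (A.last.length - d) + 1) = y := by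
    have := hS.dist (s.length - (k - d)) (by omega) (by simp; omega)
    rw [List.length_cons, show s.length + 1 - (s.length - (k - d)) = k - d + 1 by omega, hy,
      show s.length - (k - d) + 1 = s.length - (A.last.length - d) + 1 by omega] at this
    exact (Option.some_inj.1 this).symm
  have hy2 : y ≤ k - d + 1 := by
    obtain ⟨h', rfl⟩ := List.getElem?_eq_some_iff.1 hy
    exact pd_getElem_le _ _ _
  have hchild : M2 2 (blk p) < N := by
    obtain ⟨vs, -, h', h''⟩ := hT2.children p hpT
    rcases vs with _ | ⟨w, vs⟩
    · have : M2 2 (blk p) = 0 := h''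
      omega
    · have := hT2.bounds w ((h' w).1 (by simp)).1
      have e : M2 2 (blk p) = 16 * blk w := h''.1
      omega
  obtain ⟨w7, w8, w10, h6⟩ := Runs.create (N := N) (X := X) (M := M2) (cur := 16 * blk v)
    (mode := 1) (m := s.length) (dep := A.last.length - d) (a := rslLabel (x :: s) v) (r7 := u7)
    (r8 := u8) (r9 := u9) (r10 := u10) (r12 := 16 * blk v') (r13 := a') (rc := s.length + 1)
    (w := blk p) (f := q.1) (b := q.2) hN (by omega) (by omega) hqb.1 hqb.2 (by omega) hchild
  rw [hy1] at h6
  have hu : B.last = p ++ [y] := by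
    obtain ⟨h', rfl⟩ := List.getElem?_eq_some_iff.1 hy
    rw [hBc.last, hp]
    exact List.take_succ_eq_append_getElem h'
  have hslB : suffixLink B.last = v' := by
    rw [hBc.last, suffixLink_take, hv', hA.anc_last, show k - (d - 1) = k - d + 1 by omega]
  have hcard : (frontPointers B.last).card = a' := by
    rw [ha', hv', hA.anc_last, rslLabel_take x s (by omega), hBc.last,
      show k - (d - 1) + 1 = k - d + 2 by omega]
  have hBT : B.last ∉ A.nodes := by
    rw [hBc.last, hA.nodes]
    exact hBc.depth.notMem
  have hT3 := hT2.create hA.dropLast_mem hA.suffixLink_mem hu hpT hBT hslB hv'T hcard hlL'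
    (hT2.find_of_rsl_none hA hv'T (hnone (d - 1) (by omega))) hq.symm
  rw [← hBn] at hT3
  set M3 := createBlocks M2 s.length (blk p) y (16 * blk v') a' q.1 q.2 with hM3
  have hq8 : q.1 ≤ 8 := by
    rcases (tree v').place_eq_or a' (8, blk v') with h' | ⟨h', -⟩
    · rw [← hq] at h'
      simp [h']
    · rw [← hq] at h'
      omega
  have hq6 : 6 ≤ q.1 := by
    rcases (tree v').place_eq_or a' (8, blk v') with h' | ⟨h', -⟩
    · rw [← hq] at h'
      simp [h']
    · rw [← hq] at h'
      omega
  have hM3' : ∀ g, 9 ≤ g → ∀ b, M3 g b = M2 g b := by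
    intro g hg b
    rw [hM3, createBlocks_apply_of_le (by omega), put, if_neg (by omega)]
  refine ⟨1 + (n2 + (n3 + (3 + (n5 + 26)))), tr, _, _, B, hB,
    ⟨k - d + 2, M3, Z2, _, _, rslLabel (x :: s) v, 16 * blk p, w7, w8, u9, w10, 16 * q.2 + q.1,
      16 * blk v', a', ⟨hBc, hT3, ⟨hS.sorted, hS.mem_iff, ?_, ?_⟩, ?_⟩, rfl, rfl⟩, ?_, ?_, ?_⟩
  · exact hS.chained.congr fun y _ => hM3' 9 le_rfl _
  · intro y h1 h2
    rw [hM3' 10 (by omega)]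
    exact hS.dist y h1 h2
  · intro b hb
    rw [List.length_cons] at hb
    rw [hM3' 10 (by omega), hM2 10 b (Or.inr (by omega))]
    exact hI.unused b (by omega)
  · obtain ⟨j, rfl⟩ : ∃ j, k = j + d := ⟨k - d, by omega⟩
    rw [Nat.add_sub_cancel]
    simp only [Nat.add_mul]
    omega
  · have h7 := h1.append (h2.trans (h3.append (h4.trans (h5.trans h6))))
    rw [Function.update_self]
    rw [hlast] at h7
    simpa using h7
  · rw [climbSnapshots, hcd]
    exact htr

theorem initialBlocks_eq : initialBlocks = createBlocks (fun _ _ => 0) 0 1 0 16 0 8 1 := by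
  funext g y
  simp only [initialBlocks, createBlocks, put]
  split_ifs <;> omega

/-- The first node is created like the others, from a trie that consists of the root. -/
theorem TreeInv.base (L : ℕ) : ∃ blk tree, blk [0] = 2 ∧
    TreeInv 1 AlgState.base.nodes initialBlocks blk tree L := by
  have h0 : TreeInv 0 {[]} (fun _ _ => 0) (fun _ => 1) (fun _ => .leaf) L := by
    refine ⟨?_, rfl, ?_, ?_, ?_, ?_, ?_, ?_, ?_, ?_, ?_, ?_, ?_, ?_⟩
    · simp
    · simp
    · simp
    · simp
    · intro u hu
      obtain rfl := Finset.mem_singleton.1 hu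
      exact ⟨[], List.nodup_nil, by simp, rfl⟩
    · simp
    · simp
    · exact fun v _ => rfl
    · exact fun v _ => List.nodup_nil
    · exact fun v _ => trivial
    · intro v hv b
      simp [SearchTree.support]
    · simp
    · simp
  have h1 := h0.create (p := []) (c := 0) (u := [0]) (v' := []) (a := 0) (q := (8, 1)) (by simp)
    (by simp) rfl (by simp) (by simp) rfl (by simp) rfl (by simp) rfl rfl
  rw [initialBlocks_eq, show AlgState.base.nodes = insert [0] {[]} from Finset.pair_comm _ _]
  exact ⟨_, _, Function.update_self _ _ _, h1⟩

theorem stringInv_singleton (x : α) : StringInv [x] initialBlocks [1] := by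
  refine ⟨by simp, fun y => ?_, ⟨rfl, rfl⟩, fun y h1 h2 => ?_⟩
  · rw [List.mem_singleton, pd_singleton]
    constructor
    · rintro rfl
      simp
    · rintro ⟨h1, h2, -⟩
      exact le_antisymm h2 h1
  · obtain rfl : y = 1 := le_antisymm h2 h1
    rw [pd_singleton]
    rfl

/-- The configuration after the first character. -/
theorem Ready.base (x : α) (L : ℕ) :
    Ready [x] AlgState.base L (15 + (14 * L + 24))
      ⟨15, regs (file 32 0 1 1 0 0 36 0 0 0 0 0 0), blocks initialBlocks, 1⟩ := by
  obtain ⟨blk, tree, hb, hT⟩ := TreeInv.base L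
  refine ⟨1, _, [1], blk, tree, 0, 0, 36, 0, 0, 0, 0, 0, 0,
    ⟨isCorrect_base x, hT, stringInv_singleton x, fun b hb => ?_⟩, by simp, ?_⟩
  · simp [initialBlocks, put]
  · rw [show AlgState.base.last = [0] from rfl, hb]
    rfl

/-- The run of the machine on the string `s`, which may be followed by further characters. The
trace contains all snapshots but the last one, which belongs to the final configuration `c`. -/
theorem exists_ready {L : ℕ} (hL : ∀ w : List α, (frontPointers (pd w)).card < 2 ^ L)
    (hs : s ≠ []) (hX : ∀ k < s.length, X[k]? = s.reverse[k]?) (hN : 16 * (s.length + 1) + 15 < N) :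
    ∃ A n tr c w tr', algorithm s = some A ∧ Ready s A L w c ∧
      n + w ≤ s.length * (3 * (14 * L + 24) + 41) ∧ Runs N X n tr Config.init c ∧
      snapshots s = tr' ++ [⟨A, A.last, s.length⟩] ∧ List.Forall₂ (Holds N) tr tr' := by
  induction s with
  | nil => exact absurd rfl hs
  | cons x s ih =>
    rcases s with _ | ⟨y, s⟩
    · have hX0 : X ≠ [] := by
        rintro rfl
        simpa using hX 0 (by simp)
      refine ⟨AlgState.base, 15, [], _, _, [], rfl, Ready.base x L, ?_,
        Runs.first_char hX0 (by simpa using hN), ?_, .nil⟩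
      · simp
        omega
      · simp [snapshots, algorithm, AlgState.base]
    · simp only [List.length_cons] at hX hN ⊢
      obtain ⟨A, n, tr, c, w, tr', hA, hR, hn, hrun, hsnap, htr⟩ := ih (by simp)
        (fun k hk => by
          simp only [List.length_cons] at hk
          rw [hX k (by omega), List.reverse_cons (a := x), List.getElem?_append_left (by simp; omega)])
        (by simp only [List.length_cons]; omega)
      obtain ⟨n', tr1, c', w', B, hB, hR', hn', hrun', htr1⟩ := hR.step (X := X) (N := N) hL x
        (fun k hk => hX k (by simp only [List.length_cons] at hk; omega)) (by simp; omega)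
      have hB' : algorithm (x :: y :: s) = some B := by
        rw [algorithm, hA]
        exact hB
      refine ⟨B, n + n', tr ++ c :: tr1, c', w', tr' ++ [⟨A, A.last, (y :: s).length⟩] ++
        climbSnapshots A (x :: y :: s), hB', hR', ?_, hrun.append hrun', ?_, ?_⟩
      · simp only [List.length_cons] at hn
        rw [Nat.succ_mul]
        omega
      · rw [snapshots, hA, hB', hsnap]
        rfl
      · rw [List.append_assoc]
        refine List.rel_append htr (.cons (hR.holds (by simp; omega)) htr1)

/-- The program runs the algorithm in linear memory and in time `O(n (1 + log σ))`. The blocks up to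
number `n + 1` are used, and every character costs a constant number of instructions, pieces of
the climb and searches among labels with at most `1 + log σ` digits. -/
theorem executes [Fintype α] (S : List α) (hS : S ≠ []) :
    Executes program observed (200 * S.length)
      (200 * (S.length * (1 + Nat.log 2 (Fintype.card α)))) S := by
  have hpos := List.length_pos_iff.2 hS
  obtain ⟨A, n, tr, c, w, tr', hA, hR, hn, hrun, hsnap, htr⟩ := exists_ready (X := S.reverse)
    (N := 200 * S.length) (L := Nat.log 2 (Fintype.card α) + 1)
    (fun w => (card_frontPointers_pd_le w).trans_lt (Nat.lt_pow_succ_log_self (by omega) _))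
    hS (fun _ _ => rfl) (by omega)
  have hc := hR.holds (N := 200 * S.length) (by omega)
  obtain ⟨k, M, Z, blk, tree, r5, r6, r7, r8, r9, r10, r11, r12, r13, hI, -, rfl⟩ := hR
  have h1 := (Runs.observe_pos (N := 200 * S.length) (X := S.reverse) (M := M) (rc := S.length)
    (R := file (16 * blk A.last) 0 S.length k r5 r6 r7 r8 r9 r10 r11 r12 r13) rfl (.refl _)).append
    (Runs.no_char (by simp))
  obtain ⟨cs, h2, h3, h4, h5, h6⟩ := (hrun.append h1).exists_isChain (by simp)
  refine ⟨cs, _, ⟨h2, h3, h4, rfl⟩, ?_, ?_, ?_⟩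
  · rw [h5]
    refine (?_ : _ ≤ S.length * (3 * (14 * (Nat.log 2 (Fintype.card α) + 1) + 24) + 41) + 3).trans ?_
    · omega
    · generalize Nat.log 2 (Fintype.card α) = g
      nlinarith [Nat.zero_le (S.length * g)]
  · rw [h6, hsnap]
    exact List.rel_append htr (.cons hc .nil)
  · intro B hB
    obtain rfl : A = B := Option.some_inj.1 (hA.symm.trans hB)
    have := hI.correct.anc_mem 0
    rw [anc, Nat.sub_zero, List.take_length] at this
    exact hI.tree.holds hI.correct (by omega) this rfl rfl

theorem exists_isCorrect (s : List α) (hs : s ≠ []) :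
    ∃ A k, algorithm s = some A ∧ IsCorrect s A k := by
  induction s with
  | nil => exact absurd rfl hs
  | cons x s ih =>
    rcases s with _ | ⟨y, s⟩
    · exact ⟨_, _, rfl, isCorrect_base x⟩
    · obtain ⟨A, k, hA, hc⟩ := ih (by simp)
      obtain ⟨d, -, -, -, -, -, B, hB, -, hBc⟩ := hc.step x
      exact ⟨B, _, by rw [algorithm, hA]; exact hB, hBc⟩

end Iteration

end CartesianHeap

theorem theorem1 :
    -- correctness: after the iteration for `i`, the algorithm has built the heap of `S[i..]`,
    -- with exactly its reversed suffix links, and its last node is the new node of the heap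
    (∀ (α : Type*) [LinearOrder α] (S : List α) (i : ℕ), 1 ≤ i → i ≤ S.length →
      ∃ A : CartesianHeap.AlgState,
        CartesianHeap.algorithm (S.drop (i - 1)) = some A ∧
        A.nodes = CartesianHeap.cph (S.drop (i - 1)) ∧
        (∀ v a u, A.rsl v a = some u ↔ CartesianHeap.IsRsl A.nodes v a u) ∧
        CartesianHeap.newNode (CartesianHeap.cph (S.drop i))
          (CartesianHeap.pd (S.drop (i - 1))) = some A.last) ∧
    -- complexity: one program executes the algorithm on all strings over all finite alphabets,
    -- in time `O(n log σ)` and with `O(n)` words of memory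
    (∃ (P : List CartesianHeap.Instr) (l C : ℕ),
      ∀ (α : Type*) [LinearOrder α] [Fintype α] (S : List α), S ≠ [] →
        CartesianHeap.Executes P l (C * S.length)
          (C * (S.length * (1 + Nat.log 2 (Fintype.card α)))) S) := by
  refine ⟨fun α _ S i h1 h2 => ?_, CartesianHeap.program, CartesianHeap.observed, 200,
    fun α _ _ S hS => CartesianHeap.executes S hS⟩
  have hS : S.drop (i - 1) = S[i - 1]'(by omega) :: S.drop i := by
    rw [List.drop_eq_getElem_cons (by omega), Nat.sub_add_cancel h1]
  rw [hS]
  obtain ⟨A, k, hA, hc⟩ := CartesianHeap.exists_isCorrect (S[i - 1]'(by omega) :: S.drop i) (by simp)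
  exact ⟨A, hA, hc.nodes, hc.rsl, by rw [hc.depth.newNode, hc.last]⟩
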